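/- **Setting.** Consider a finite-horizon MDP with finite state set $\mathcal S$ ($S$ states), finite action set $\mathcal A$ ($A$ actions), horizon $H$, transition probabilities $P(y\mid x,a)$ that do not depend on the step, and known deterministic rewards $R(x,a)\in[0,1]$. A policy is a map $\pi:\mathcal S\times\{1,\dots,H\}\to\mathcal A$; $V^\pi_h(x)$ is the expected sum of the rewards received at steps $h,\dots,H$ when $\pi$ is followed from state $x$ at step $h$, and $V^*_h(x)=\sup_\pi V^\pi_h(x)$. A learner interacts with the MDP for $K$ episodes. In episode $k$ the environment chooses an initial state $x_{k,1}$ arbitrarily (possibly at random and depending on the past), and the learner follows a policy $\pi_k$ for $H$ steps. Put $T=KH$ and $\mathrm{Regret}(K)=\sum_{k=1}^K\big(V^*_1(x_{k,1})-V^{\pi_k}_1(x_{k,1})\big)$. **Algorithm (UCBVI-CH with parameter $\delta>0$).** Before episode $k$, let $N_k(x,a,y)$ be the number of transitions $(x,a,y)$ observed in episodes $1,\dots,k-1$, let $N_k(x,a)=\sum_yN_k(x,a,y)$, and let $\widehat P_k(y\mid x,a)=N_k(x,a,y)/N_k(x,a)$ if $N_k(x,a)>0$. Put $V_{k,H+1}=0$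 and, for $h=H,\dots,1$, $$Q_{k,h}(x,a)=\min\Big(Q_{k-1,h}(x,a),\,H,\,R(x,a)+\sum_y\widehat P_k(y\mid x,a)V_{k,h+1}(y)+b_k(x,a)\Big)$$ if $N_k(x,a)>0$, and $Q_{k,h}(x,a)=H$ otherwise; $V_{k,h}(x)=\max_aQ_{k,h}(x,a)$. The bonus is $$b_k(x,a)=7H\ln(5SAT/\delta)\sqrt{1/N_k(x,a)}.$$ In episode $k$ the learner plays $\pi_k(x,h)\in\arg\max_aQ_{k,h}(x,a)$, with ties broken in any way. **Theorem.** Let $\delta>0$ and $L=\ln(5HSAT/\delta)$. With probability at least $1-\delta$, UCBVI-CH satisfies $$\mathrm{Regret}(K)\le 20\,H^{3/2}L\sqrt{SAK}+250\,H^2S^2A\,L^2 .$$ Moreover this is $\widetilde O(H\sqrt{SAT})$ for large $T$: if $T\ge H^2S^3A$, then with probability at least $1-\delta$, $\mathrm{Regret}(K)\le 270\,H\sqrt{SAT}\,L^2$. -/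

import Mathlib

noncomputable section

namespace UCBVI

/-- A finite-horizon Markov decision process with state space `S`, action space `A`,
horizon `H`, time-homogeneous transition law `P x a` of the next state, and deterministic
rewards `R x a ∈ [0,1]`. -/
structure MDP (S A : Type*) where
  H : ℕ
  P : S → A → PMF S
  R : S → A → ℝ
  R_mem : ∀ x a, R x a ∈ Set.Icc (0 : ℝ) 1

/-- A (deterministic, time-dependent) policy: `π h x` is the action taken in state `x` at step
`h`, with `h = 1, …, H`. Values at other `h` are irrelevant. -/
abbrev Policy (S A : Type*) := ℕ → S → A

/-- An observed transition `(x, a, y)`: in state `x`, action `a` was taken, and the next state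
was `y`. -/
abbrev Transition (S A : Type*) := S × A × S

/-- The record of one episode: the initial state together with the list of its transitions in
chronological order. -/
abbrev Episode (S A : Type*) := S × List (Transition S A)

variable {S A : Type*}

namespace MDP

/-- The law of the next `n` transitions when policy `π` is followed from state `x` at step `h`. -/
def rollout (M : MDP S A) (π : Policy S A) : ℕ → ℕ → S → PMF (List (Transition S A))
  | 0, _, _ => PMF.pure []
  | n + 1, h, x =>
      (M.P x (π h x)).bind fun y => (rollout M π n (h + 1) y).map fun τ => (x, π h x, y) :: τ

/-- The sum of the rewards along a list of transitions. -/
def totalReward (M : MDP S A) (τ : List (Transition S A)) : ℝ :=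
  (τ.map fun t => M.R t.1 t.2.1).sum

/-- `V^π_h(x)`: the expected sum of the rewards received at steps `h, h+1, …, H` when policy `π`
is followed from state `x` at step `h`. (For finite `S` the law has finite support.) -/
def value (M : MDP S A) (π : Policy S A) (h : ℕ) (x : S) : ℝ :=
  ∑' τ : List (Transition S A), (M.rollout π (M.H + 1 - h) h x τ).toReal * M.totalReward τ

/-- `V^*_h(x) = sup_π V^π_h(x)`. -/
def optValue (M : MDP S A) (h : ℕ) (x : S) : ℝ :=
  ⨆ π : Policy S A, M.value π h x

end MDP

section Algorithm

variable [Fintype S] [DecidableEq S] [DecidableEq A]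

/-- `N(x,a,y)`: the number of transitions `(x,a,y)` in the data `D`. -/
def countTrans (D : List (Episode S A)) (x : S) (a : A) (y : S) : ℕ :=
  (D.flatMap Prod.snd).count (x, a, y)

/-- `N(x,a) = ∑_y N(x,a,y)`. -/
def countPair (D : List (Episode S A)) (x : S) (a : A) : ℕ :=
  ∑ y, countTrans D x a y

/-- The empirical transition probability `N(x,a,y) / N(x,a)` (only used when `N(x,a) > 0`). -/
def empP (D : List (Episode S A)) (x : S) (a : A) (y : S) : ℝ :=
  (countTrans D x a y : ℝ) / (countPair D x a : ℝ)

variable [Fintype A]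

/-- The Chernoff–Hoeffding bonus `7 H L √(1/N(x,a))` with `L = ln(5 S A T / δ)`, `T = K H`. -/
def bonusCH (M : MDP S A) (K : ℕ) (δ : ℝ) (D : List (Episode S A)) (x : S) (a : A) : ℝ :=
  7 * M.H * Real.log (5 * Fintype.card S * Fintype.card A * ((K : ℝ) * M.H) / δ) *
    √(1 / (countPair D x a : ℝ))

/-- Optimistic value iteration on data `D`, given the Q-values `Qprev` of the previous episode.
The argument `n` is the number of steps to go: `n = H + 1 - h` at step `h`. For `n = 0`
everything is zero, which encodes `V_{H+1} = 0`. -/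
def ucbStep (M : MDP S A) (K : ℕ) (δ : ℝ) (Qprev : ℕ → S → A → ℝ) (D : List (Episode S A)) :
    ℕ → S → A → ℝ
  | 0, _, _ => 0
  | n + 1, x, a =>
      if 0 < countPair D x a then
        min (Qprev (n + 1) x a) (min (M.H : ℝ)
          (M.R x a + ∑ y, empP D x a y * (⨆ b : A, ucbStep M K δ Qprev D n y b)
            + bonusCH M K δ D x a))
      else (M.H : ℝ)

/-- The Q-values computed from the data `D` of all past episodes (most recent episode first),
indexed by the number of steps to go. The Q-values of the previous episode are those computed
from the tail of `D`. Before the first episode no pair has been visited, so that the initial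
value `H` of `Qprev` is never used there. -/
def ucbQToGo (M : MDP S A) (K : ℕ) (δ : ℝ) : List (Episode S A) → ℕ → S → A → ℝ
  | [] => ucbStep M K δ (fun _ _ _ => (M.H : ℝ)) []
  | e :: D => ucbStep M K δ (ucbQToGo M K δ D) (e :: D)

/-- `Q_{k,h}(x,a)`, where `D` is the data of episodes `1, …, k-1` and `h = 1, …, H`. -/
def ucbQ (M : MDP S A) (K : ℕ) (δ : ℝ) (D : List (Episode S A)) (h : ℕ) (x : S) (a : A) : ℝ :=
  ucbQToGo M K δ D (M.H + 1 - h) x a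

/-- A learner, mapping the data of the past episodes to the policy of the next episode, is an
instance of UCBVI-CH (for `K` episodes, with parameter `δ`) if it always plays an action
maximizing `Q_{k,h}(x, ·)`. Ties may be broken in any way. -/
def IsUCBVICH (M : MDP S A) (K : ℕ) (δ : ℝ) (learner : List (Episode S A) → Policy S A) : Prop :=
  ∀ (D : List (Episode S A)) (h : ℕ), 1 ≤ h → h ≤ M.H → ∀ (x : S) (a : A),
    ucbQ M K δ D h x a ≤ ucbQ M K δ D h x (learner D h x)

end Algorithm

/-- The law of the data of the first `k` episodes (most recent episode first). In every episode
the environment chooses the initial state, possibly at random and depending on the whole past,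
and then the policy chosen by the learner is followed for `H` steps. -/
def interaction (M : MDP S A) (init : List (Episode S A) → PMF S)
    (learner : List (Episode S A) → Policy S A) : ℕ → PMF (List (Episode S A))
  | 0 => PMF.pure []
  | k + 1 => (interaction M init learner k).bind fun D => (init D).bind fun x =>
      (M.rollout (learner D) M.H 1 x).map fun τ => (x, τ) :: D

/-- The regret `∑_k (V^*_1(x_{k,1}) - V^{π_k}_1(x_{k,1}))` of the learner on given data, where
`π_k` is the policy that the learner chooses from the data of the episodes before `k`. -/
def regret (M : MDP S A) (learner : List (Episode S A) → Policy S A) :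
    List (Episode S A) → ℝ
  | [] => 0
  | e :: D => regret M learner D + (M.optValue 1 e.1 - M.value (learner D) 1 e.1)

end UCBVI

end

/-! The proof combines optimism with a recursive bound on how optimistic the algorithm can be. On a
concentration event the optimistic value `maxQ` dominates the optimal value
(`add_mean_optVal_le_ucbQToGo`), so the regret of an episode is at most `gap`, the optimistic value
minus the value of the played policy, at the initial state.

The gap obeys a one-step recursion (`gap_succ_le`). The model error splits as (P̂ - P)V = (P̂ - P)V*
+ (P̂ - P)(V - V*). Since V* does not depend on the data, Hoeffding bounds the first term by
H√(2l/N) without a factor S. For the second, the entrywise bound p̂ ≤ (1 + λ)p + l/(λN) gives λ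
times the mean gap, absorbed in the recursion, plus SHl/(λN). With λ = 1/(25H), the factor (1 + λ)^H
stays below 1.041.

Unrolling replaces mean gaps by gaps along the actual trajectory; an exponential supermartingale
over all episodes (`ev_exp_gapExcess_le`) bounds the total discrepancy by order H√(lT). What remains
is a sum of errors over visited pairs (`regret_le_gapExcess_add`): the 1/√N terms give √(SAT) by
Cauchy–Schwarz, the 1/N terms a logarithm.

All probability enters through exponentials of mean at most 1, Markov's inequality and a union
bound. Random visit counts are covered by one exponential per possible count. -/

noncomputable section

open scoped ENNReal

namespace UCBVI

/-! ### Expectations under discrete laws and Hoeffding's lemma. -/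

section Expectation

variable {α β : Type*}

/-- The expectation of a nonnegative function under a discrete law. -/
def ev (p : PMF α) (f : α → ℝ≥0∞) : ℝ≥0∞ := ∑' a, p a * f a

lemma ev_pure (a : α) (f : α → ℝ≥0∞) : ev (PMF.pure a) f = f a := by
  classical
  unfold ev
  rw [tsum_eq_single a]
  · simp
  · intro b hb
    simp [hb]

lemma ev_bind (p : PMF α) (q : α → PMF β) (f : β → ℝ≥0∞) :
    ev (p.bind q) f = ev p fun a => ev (q a) f := by
  unfold ev
  simp only [PMF.bind_apply, ← ENNReal.tsum_mul_right, ← ENNReal.tsum_mul_left, mul_assoc]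
  exact ENNReal.tsum_comm

lemma ev_map (p : PMF α) (g : α → β) (f : β → ℝ≥0∞) :
    ev (p.map g) f = ev p fun a => f (g a) := by
  rw [PMF.map, ev_bind]
  simp [ev_pure]

lemma ev_mono (p : PMF α) {f g : α → ℝ≥0∞} (h : ∀ a, p a ≠ 0 → f a ≤ g a) :
    ev p f ≤ ev p g := by
  refine ENNReal.tsum_le_tsum fun a => ?_
  by_cases ha : p a = 0
  · simp [ha]
  · exact mul_le_mul_right (h a ha) _

lemma ev_const (p : PMF α) (c : ℝ≥0∞) : ev p (fun _ => c) = c := by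
  rw [ev, ENNReal.tsum_mul_right, p.tsum_coe, one_mul]

lemma ev_const_mul (p : PMF α) (c : ℝ≥0∞) (f : α → ℝ≥0∞) :
    ev p (fun a => c * f a) = c * ev p f := by
  simp only [ev, ← ENNReal.tsum_mul_left]
  exact tsum_congr fun a => mul_left_comm _ _ _

lemma ev_add (p : PMF α) (f g : α → ℝ≥0∞) :
    ev p (fun a => f a + g a) = ev p f + ev p g := by
  simp only [ev, mul_add, ENNReal.tsum_add]

lemma ev_sum {ι : Type*} (p : PMF α) (s : Finset ι) (f : ι → α → ℝ≥0∞) :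
    ev p (fun a => ∑ i ∈ s, f i a) = ∑ i ∈ s, ev p (f i) := by
  classical
  induction s using Finset.induction_on with
  | empty => simp [ev]
  | insert i s hi ih => simp only [Finset.sum_insert hi, ev_add, ih]

lemma ev_indicator (p : PMF α) (s : Set α) :
    ev p (s.indicator 1) = p.toOuterMeasure s := by
  rw [PMF.toOuterMeasure_apply]
  refine tsum_congr fun a => ?_
  by_cases ha : a ∈ s <;> simp [ha]

lemma ev_ofReal [Fintype α] (p : PMF α) (f : α → ℝ) (hf : ∀ a, 0 ≤ f a) :
    ev p (fun a => ENNReal.ofReal (f a)) = ENNReal.ofReal (∑ a, (p a).toReal * f a) := by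
  rw [ev, tsum_fintype, ENNReal.ofReal_sum_of_nonneg]
  · refine Finset.sum_congr rfl fun a _ => ?_
    rw [ENNReal.ofReal_mul ENNReal.toReal_nonneg, ENNReal.ofReal_toReal (p.apply_ne_top a)]
  · exact fun a _ => mul_nonneg ENNReal.toReal_nonneg (hf a)

lemma sum_toReal [Fintype α] (p : PMF α) : ∑ a, (p a).toReal = 1 := by
  have h := p.tsum_coe
  rw [tsum_fintype] at h
  rw [← ENNReal.toReal_sum (fun a _ => p.apply_ne_top a), h, ENNReal.toReal_one]

/-- The mean of a function on a finite type. -/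
def mean [Fintype α] (p : PMF α) (f : α → ℝ) : ℝ := ∑ a, (p a).toReal * f a

lemma mean_mono [Fintype α] (p : PMF α) {f g : α → ℝ} (h : ∀ a, f a ≤ g a) :
    mean p f ≤ mean p g :=
  Finset.sum_le_sum fun a _ => mul_le_mul_of_nonneg_left (h a) ENNReal.toReal_nonneg

lemma mean_const [Fintype α] (p : PMF α) (c : ℝ) : mean p (fun _ => c) = c := by
  rw [mean, ← Finset.sum_mul, sum_toReal, one_mul]

lemma mean_sub [Fintype α] (p : PMF α) (f g : α → ℝ) :
    mean p (fun a => f a - g a) = mean p f - mean p g := by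
  simp [mean, mul_sub, Finset.sum_sub_distrib]

lemma mean_nonneg [Fintype α] (p : PMF α) {f : α → ℝ} (h : ∀ a, 0 ≤ f a) : 0 ≤ mean p f :=
  Finset.sum_nonneg fun a _ => mul_nonneg ENNReal.toReal_nonneg (h a)

/-- Hoeffding's bound for the moment generating function of a centred variable in `[-b, b]`. -/
lemma mean_exp_le [Fintype α] (p : PMF α) (f : α → ℝ) (b s : ℝ)
    (h0 : ∀ a, 0 ≤ f a) (hb : ∀ a, f a ≤ b) :
    mean p (fun a => Real.exp (s * (f a - mean p f))) ≤ Real.exp (s ^ 2 * b ^ 2 / 2) := by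
  set m := mean p f with hm
  have hm0 : 0 ≤ m := mean_nonneg p h0
  have hmb : m ≤ b := (mean_mono p hb).trans_eq (mean_const p b)
  rcases (hm0.trans hmb).eq_or_lt with hb0 | hb0
  · have : ∀ a, f a = 0 := fun a => le_antisymm (by rw [hb0]; exact hb a) (h0 a)
    have hm0 : m = 0 := by linarith
    simp [this, hm0, mean_const, ← hb0]
  -- Since `f a - m` lies in [-b, b], convexity bounds the exponential by its chord over [-sb, sb].
  -- The linear part of the chord averages to zero, leaving cosh(sb).
  have key : ∀ a, Real.exp (s * (f a - m)) ≤
      Real.cosh (s * b) + (f a - m) / b * Real.sinh (s * b) := by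
    intro a
    have h1 : 0 ≤ (1 + (f a - m) / b) / 2 := by
      have : -1 ≤ (f a - m) / b := by rw [le_div_iff₀ hb0]; linarith [h0 a]
      linarith
    have h2 : 0 ≤ (1 - (f a - m) / b) / 2 := by
      have : (f a - m) / b ≤ 1 := by rw [div_le_iff₀ hb0]; linarith [hb a]
      linarith
    have := convexOn_exp.2 (Set.mem_univ (s * b)) (Set.mem_univ (-(s * b))) h1 h2 (by ring)
    simp only [smul_eq_mul] at this
    rw [Real.cosh_eq, Real.sinh_eq]
    have e : (1 + (f a - m) / b) / 2 * (s * b) + (1 - (f a - m) / b) / 2 * -(s * b)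
        = s * (f a - m) := by
      field_simp
      ring
    rw [e] at this
    exact this.trans_eq (by ring)
  refine (mean_mono p key).trans ?_
  have : mean p (fun a => Real.cosh (s * b) + (f a - m) / b * Real.sinh (s * b))
      = Real.cosh (s * b) := by
    have h1 : mean p (fun a => f a - m) = 0 := by
      rw [mean_sub, mean_const, sub_self]
    have h2 : mean p (fun a => Real.cosh (s * b) + (f a - m) / b * Real.sinh (s * b))
        = mean p (fun _ => Real.cosh (s * b)) + mean p (fun a => f a - m) * (Real.sinh (s * b) / b) := by
      simp only [mean, Finset.sum_mul, ← Finset.sum_add_distrib]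
      exact Finset.sum_congr rfl fun a _ => by ring
    rw [h2, h1, mean_const]
    ring
  rw [this]
  refine (Real.cosh_le_exp_half_sq _).trans_eq ?_
  ring_nf

end Expectation

/-! ### Rollouts and backward recursions for values. -/

section Markov

variable {S A : Type*}

lemma ev_rollout_succ (M : MDP S A) (π : Policy S A) (n h : ℕ) (x : S)
    (f : List (Transition S A) → ℝ≥0∞) :
    ev (M.rollout π (n + 1) h x) f = ev (M.P x (π h x)) fun y =>
      ev (M.rollout π n (h + 1) y) fun τ => f ((x, π h x, y) :: τ) := by
  rw [MDP.rollout, ev_bind]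
  simp only [ev_map]

lemma ev_interaction_succ (M : MDP S A) (init : List (Episode S A) → PMF S)
    (learner : List (Episode S A) → Policy S A) (k : ℕ) (f : List (Episode S A) → ℝ≥0∞) :
    ev (interaction M init learner (k + 1)) f = ev (interaction M init learner k) fun D =>
      ev (init D) fun x => ev (M.rollout (learner D) M.H 1 x) fun τ => f ((x, τ) :: D) := by
  rw [interaction, ev_bind]
  simp only [ev_bind, ev_map]

lemma length_of_rollout_ne_zero (M : MDP S A) (π : Policy S A) (n : ℕ) :
    ∀ (h : ℕ) (x : S) (τ : List (Transition S A)), M.rollout π n h x τ ≠ 0 → τ.length = n := by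
  induction n with
  | zero =>
    intro h x τ hτ
    rw [← PMF.mem_support_iff, MDP.rollout, PMF.mem_support_pure_iff] at hτ
    simp [hτ]
  | succ n ih =>
    intro h x τ hτ
    rw [← PMF.mem_support_iff, MDP.rollout, PMF.mem_support_bind_iff] at hτ
    obtain ⟨y, -, hτ⟩ := hτ
    rw [PMF.mem_support_map_iff] at hτ
    obtain ⟨τ', hτ', rfl⟩ := hτ
    simp [ih _ _ _ ((PMF.mem_support_iff _ _).1 hτ')]

lemma length_of_interaction_ne_zero (M : MDP S A) (init : List (Episode S A) → PMF S)
    (learner : List (Episode S A) → Policy S A) (k : ℕ) :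
    ∀ D, interaction M init learner k D ≠ 0 → D.length = k ∧ ∀ e ∈ D, e.2.length = M.H := by
  induction k with
  | zero =>
    intro D hD
    rw [← PMF.mem_support_iff, interaction, PMF.mem_support_pure_iff] at hD
    simp [hD]
  | succ k ih =>
    intro D hD
    rw [← PMF.mem_support_iff, interaction, PMF.mem_support_bind_iff] at hD
    obtain ⟨D', hD', hD⟩ := hD
    rw [PMF.mem_support_bind_iff] at hD
    obtain ⟨x, -, hD⟩ := hD
    rw [PMF.mem_support_map_iff] at hD
    obtain ⟨τ, hτ, rfl⟩ := hD
    obtain ⟨h1, h2⟩ := ih D' hD'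
    have := length_of_rollout_ne_zero _ _ _ _ _ _ hτ
    simpa [h1, this] using h2

variable [Fintype S]

/-- The value of a policy with `n` steps to go, starting at step `h`, by backward recursion. -/
def polVal (M : MDP S A) (π : Policy S A) : ℕ → ℕ → S → ℝ
  | 0, _, _ => 0
  | n + 1, h, x => M.R x (π h x) + mean (M.P x (π h x)) (polVal M π n (h + 1))

/-- The optimal value with `n` steps to go, by backward recursion. -/
def optVal (M : MDP S A) : ℕ → S → ℝ
  | 0, _ => 0
  | n + 1, x => ⨆ a, (M.R x a + mean (M.P x a) (optVal M n))

/-- Conditioning on the first next state turns the trajectory sum defining `value` into the Bellman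
recursion; prepending a fixed transition is injective, so the sum over tails reindexes exactly. -/
lemma hasSum_rollout (M : MDP S A) (π : Policy S A) (n : ℕ) :
    ∀ (h : ℕ) (x : S),
      HasSum (fun τ => (M.rollout π n h x τ).toReal * M.totalReward τ) (polVal M π n h x) := by
  classical
  induction n with
  | zero =>
    intro h x
    have : ∀ τ, (M.rollout π 0 h x τ).toReal * M.totalReward τ = 0 := by
      intro τ
      by_cases hτ : τ = []
      · simp [hτ, MDP.totalReward]
      · simp [MDP.rollout, hτ]
    simp only [this, polVal]
    exact hasSum_zero
  | succ n ih =>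
    intro h x
    set a := π h x with ha
    have hinj (y : S) : Function.Injective fun τ : List (Transition S A) => (x, a, y) :: τ :=
      List.cons_injective
    have hstep (y : S) : HasSum (fun τ => (((M.rollout π n (h + 1) y).map
        fun τ => (x, a, y) :: τ) τ).toReal * M.totalReward τ)
        (M.R x a + polVal M π n (h + 1) y) := by
      rw [← (hinj y).hasSum_iff]
      · have h1 : HasSum (fun τ => (M.rollout π n (h + 1) y τ).toReal) 1 := by
          have := ENNReal.hasSum_toReal (f := M.rollout π n (h + 1) y) (by simp [PMF.tsum_coe])
          rwa [← ENNReal.tsum_toReal_eq fun τ => PMF.apply_ne_top _ τ, PMF.tsum_coe,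
            ENNReal.toReal_one] at this
        have h2 := (h1.mul_right (M.R x a)).add (ih (h + 1) y)
        rw [one_mul] at h2
        refine h2.congr_fun ?_
        intro τ
        have : ((M.rollout π n (h + 1) y).map fun τ => (x, a, y) :: τ) ((x, a, y) :: τ)
            = M.rollout π n (h + 1) y τ := by
          rw [PMF.map_apply, tsum_eq_single τ]
          · simp
          · intro τ' hτ'
            simp [hτ'.symm]
        simp only [Function.comp, this, MDP.totalReward, List.map_cons, List.sum_cons]
        ring
      · intro τ hτ
        have : ((M.rollout π n (h + 1) y).map fun τ => (x, a, y) :: τ) τ = 0 := by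
          rw [PMF.apply_eq_zero_iff, PMF.support_map]
          rintro ⟨τ', -, rfl⟩
          exact hτ ⟨τ', rfl⟩
        simp [this]
    have hsum := hasSum_sum fun y (_ : y ∈ Finset.univ) => (hstep y).mul_left (M.P x a y).toReal
    have heq : ∑ y, (M.P x a y).toReal * (M.R x a + polVal M π n (h + 1) y)
        = polVal M π (n + 1) h x := by
      rw [polVal, ← ha, mean]
      simp only [mul_add, Finset.sum_add_distrib]
      rw [← Finset.sum_mul, sum_toReal, one_mul]
    rw [heq] at hsum
    refine hsum.congr_fun ?_
    intro τ
    rw [MDP.rollout, PMF.bind_apply, tsum_fintype, ENNReal.toReal_sum, Finset.sum_mul]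
    · exact Finset.sum_congr rfl fun y _ => by rw [ENNReal.toReal_mul, mul_assoc]
    · exact fun y _ => ENNReal.mul_ne_top (PMF.apply_ne_top _ _) (PMF.apply_ne_top _ _)

lemma value_eq_polVal (M : MDP S A) (π : Policy S A) (h : ℕ) (x : S) :
    M.value π h x = polVal M π (M.H + 1 - h) h x :=
  (hasSum_rollout M π _ h x).tsum_eq

lemma polVal_nonneg (M : MDP S A) (π : Policy S A) (n : ℕ) :
    ∀ (h : ℕ) (x : S), 0 ≤ polVal M π n h x := by
  induction n with
  | zero => exact fun h x => le_rfl
  | succ n ih => exact fun h x => add_nonneg (M.R_mem _ _).1 (mean_nonneg _ (ih _))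

lemma optVal_le [Nonempty A] (M : MDP S A) (n : ℕ) : ∀ x : S, optVal M n x ≤ n := by
  induction n with
  | zero => intro x; simp [optVal]
  | succ n ih =>
    refine fun x => ciSup_le fun a => ?_
    have h1 := (M.R_mem x a).2
    have h2 := (mean_mono (M.P x a) ih).trans_eq (mean_const _ _)
    push_cast
    linarith

variable [Finite A]

lemma le_optVal_succ (M : MDP S A) (n : ℕ) (x : S) (a : A) :
    M.R x a + mean (M.P x a) (optVal M n) ≤ optVal M (n + 1) x :=
  le_ciSup (f := fun a => M.R x a + mean (M.P x a) (optVal M n)) (Set.finite_range _).bddAbove a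

lemma polVal_le_optVal (M : MDP S A) (π : Policy S A) (n : ℕ) :
    ∀ (h : ℕ) (x : S), polVal M π n h x ≤ optVal M n x := by
  induction n with
  | zero => exact fun h x => le_rfl
  | succ n ih =>
    intro h x
    exact le_trans (add_le_add le_rfl (mean_mono _ (ih _))) (le_optVal_succ M n x (π h x))

/-- The regret bound only needs this direction; existence of an optimal policy plays no role. -/
lemma optValue_le_optVal [Nonempty A] (M : MDP S A) (h : ℕ) (x : S) :
    M.optValue h x ≤ optVal M (M.H + 1 - h) x :=
  ciSup_le fun π => (value_eq_polVal M π h x).trans_le (polVal_le_optVal M π _ h x)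

lemma optVal_nonneg [Nonempty A] (M : MDP S A) (n : ℕ) (x : S) : 0 ≤ optVal M n x :=
  (polVal_nonneg M (fun _ _ => Classical.arbitrary A) n 0 x).trans (polVal_le_optVal M _ n 0 x)

end Markov

/-! ### Exponential supermartingales and concentration of the empirical model. -/

section Supermartingale

variable {S A : Type*}

/-- A nonnegative functional of the data that does not increase in mean over an episode has mean
at most its initial value. -/
lemma ev_interaction_le (M : MDP S A) (init : List (Episode S A) → PMF S)
    (learner : List (Episode S A) → Policy S A) (W : List (Episode S A) → ℝ≥0∞)
    (hW : ∀ D x, ev (M.rollout (learner D) M.H 1 x) (fun τ => W ((x, τ) :: D)) ≤ W D) (k : ℕ) :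
    ev (interaction M init learner k) W ≤ W [] := by
  induction k with
  | zero => rw [interaction, ev_pure]
  | succ k ih =>
    rw [ev_interaction_succ]
    refine (ev_mono _ fun D _ => ?_).trans ih
    exact (ev_mono _ fun x _ => hW D x).trans_eq (ev_const _ _)

/-- The sum of a function over all transitions in the data. -/
def transSum (g : Transition S A → ℝ) (D : List (Episode S A)) : ℝ :=
  ((D.flatMap Prod.snd).map g).sum

lemma transSum_cons (g : Transition S A → ℝ) (e : Episode S A) (D : List (Episode S A)) :
    transSum g (e :: D) = (e.2.map g).sum + transSum g D := by
  simp [transSum]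

variable [Fintype S]

/-- Each transition contributes a factor of conditional mean at most 1, whatever pair is visited, so
the factors can be peeled off one by one. -/
lemma ev_rollout_exp_le (M : MDP S A) (π : Policy S A) (g : Transition S A → ℝ)
    (hg : ∀ x a, mean (M.P x a) (fun y => Real.exp (g (x, a, y))) ≤ 1) (n : ℕ) :
    ∀ (h : ℕ) (x : S),
      ev (M.rollout π n h x) (fun τ => ENNReal.ofReal (Real.exp (τ.map g).sum)) ≤ 1 := by
  induction n with
  | zero =>
    intro h x
    rw [MDP.rollout, ev_pure]
    simp
  | succ n ih =>
    intro h x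
    rw [ev_rollout_succ]
    simp only [List.map_cons, List.sum_cons, Real.exp_add,
      ENNReal.ofReal_mul (Real.exp_nonneg _), ev_const_mul]
    refine (ev_mono _ fun y _ => mul_le_of_le_one_right' (ih _ _)).trans ?_
    rw [ev_ofReal _ _ fun y => Real.exp_nonneg _]
    exact ENNReal.ofReal_le_one.2 (hg _ _)

lemma ev_exp_transSum_le (M : MDP S A) (init : List (Episode S A) → PMF S)
    (learner : List (Episode S A) → Policy S A) (g : Transition S A → ℝ)
    (hg : ∀ x a, mean (M.P x a) (fun y => Real.exp (g (x, a, y))) ≤ 1) (k : ℕ) :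
    ev (interaction M init learner k) (fun D => ENNReal.ofReal (Real.exp (transSum g D))) ≤ 1 := by
  refine (ev_interaction_le M init learner _ (fun D x => ?_) k).trans_eq (by simp [transSum])
  simp only [transSum_cons]
  simp only [Real.exp_add, mul_comm (Real.exp (List.sum _))]
  simp only [ENNReal.ofReal_mul (Real.exp_nonneg _), ev_const_mul]
  exact mul_le_of_le_one_right' (ev_rollout_exp_le M _ g hg _ _ _)

variable [DecidableEq S] [DecidableEq A]

/-- The function of a transition that only sees the next state after a visit of `(x, a)`. -/
def pairFun (x : S) (a : A) (g : S → ℝ) (t : Transition S A) : ℝ :=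
  if t.1 = x ∧ t.2.1 = a then g t.2.2 else 0

lemma mean_exp_pairFun_le (M : MDP S A) (x : S) (a : A) (g : S → ℝ)
    (hg : mean (M.P x a) (fun y => Real.exp (g y)) ≤ 1) (x' : S) (a' : A) :
    mean (M.P x' a') (fun y => Real.exp (pairFun x a g (x', a', y))) ≤ 1 := by
  by_cases h : x' = x ∧ a' = a
  · obtain ⟨rfl, rfl⟩ := h
    simpa [pairFun] using hg
  · simp [pairFun, h, mean_const]

lemma transSum_pairFun (x : S) (a : A) (g : S → ℝ) (D : List (Episode S A)) :
    transSum (pairFun x a g) D = ∑ y, (countTrans D x a y : ℝ) * g y := by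
  unfold transSum countTrans
  generalize D.flatMap Prod.snd = l
  induction l with
  | nil => simp
  | cons t l ih =>
    obtain ⟨x', a', y'⟩ := t
    rw [List.map_cons, List.sum_cons, ih]
    by_cases h : x' = x ∧ a' = a
    · obtain ⟨rfl, rfl⟩ := h
      simp [pairFun, List.count_cons, add_mul, Finset.sum_add_distrib, add_comm]
    · have : ∀ y, ((x', a', y') == (x, a, y)) = false := by
        intro y
        simp only [beq_eq_false_iff_ne, ne_eq, Prod.mk.injEq]
        tauto
      simp [pairFun, List.count_cons, h, this]

/-- The tilting function whose exponential controls the empirical mean of `f`. -/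
def hoeffdingTilt (M : MDP S A) (x : S) (a : A) (f : S → ℝ) (s : ℝ) : Transition S A → ℝ :=
  pairFun x a fun y => s * (f y - mean (M.P x a) f) - s ^ 2 * (M.H : ℝ) ^ 2 / 2

/-- The tilting function whose exponential controls the empirical frequency of `y`. -/
def poissonTilt (M : MDP S A) (x : S) (a : A) (y : S) (lam : ℝ) : Transition S A → ℝ :=
  pairFun x a fun y' =>
    lam * (if y' = y then 1 else 0) - (M.P x a y).toReal * (Real.exp lam - 1)

lemma mean_exp_hoeffdingTilt_le (M : MDP S A) (x : S) (a : A) (f : S → ℝ) (s : ℝ)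
    (h0 : ∀ y, 0 ≤ f y) (hH : ∀ y, f y ≤ M.H) (x' : S) (a' : A) :
    mean (M.P x' a') (fun y => Real.exp (hoeffdingTilt M x a f s (x', a', y))) ≤ 1 := by
  refine mean_exp_pairFun_le M x a _ ?_ x' a'
  have h := mean_exp_le (M.P x a) f M.H s h0 hH
  simp only [Real.exp_sub, div_eq_mul_inv, mean, ← mul_assoc, ← Finset.sum_mul] at h ⊢
  rw [← div_eq_mul_inv, div_le_one (Real.exp_pos _)]
  exact h

/-- The Bernoulli moment generating function 1 + p(e^λ - 1) is at most exp(p(e^λ - 1)). -/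
lemma mean_exp_poissonTilt_le (M : MDP S A) (x : S) (a : A) (y : S) (lam : ℝ)
    (x' : S) (a' : A) :
    mean (M.P x' a') (fun y' => Real.exp (poissonTilt M x a y lam (x', a', y'))) ≤ 1 := by
  refine mean_exp_pairFun_le M x a _ ?_ x' a'
  set p := (M.P x a y).toReal with hp
  have h1 : ∀ y', Real.exp (lam * (if y' = y then 1 else 0) - p * (Real.exp lam - 1))
      = Real.exp (-(p * (Real.exp lam - 1))) * (1 + if y' = y then Real.exp lam - 1 else 0) := by
    intro y'
    rw [sub_eq_add_neg, add_comm, Real.exp_add]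
    split_ifs <;> simp
  simp only [h1, mean]
  have h2 : ∑ y', (M.P x a y').toReal * (Real.exp (-(p * (Real.exp lam - 1))) *
      (1 + if y' = y then Real.exp lam - 1 else 0))
      = Real.exp (-(p * (Real.exp lam - 1))) * (1 + p * (Real.exp lam - 1)) := by
    simp only [mul_left_comm _ (Real.exp (-(p * (Real.exp lam - 1)))), ← Finset.mul_sum]
    simp only [mul_add, Finset.sum_add_distrib, mul_one, sum_toReal]
    simp [hp]
  rw [h2, Real.exp_neg, inv_mul_le_iff₀ (Real.exp_pos _), mul_one, add_comm]
  exact Real.add_one_le_exp _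

lemma transSum_hoeffdingTilt (M : MDP S A) (x : S) (a : A) (f : S → ℝ) (s : ℝ)
    (D : List (Episode S A)) :
    transSum (hoeffdingTilt M x a f s) D = s * ((∑ y, (countTrans D x a y : ℝ) * f y)
      - countPair D x a * mean (M.P x a) f) - countPair D x a * (s ^ 2 * (M.H : ℝ) ^ 2 / 2) := by
  rw [hoeffdingTilt, transSum_pairFun, countPair, Nat.cast_sum]
  simp only [Finset.sum_mul, mul_sub, Finset.mul_sum, Finset.sum_sub_distrib]
  congr 2 <;> exact Finset.sum_congr rfl fun y _ => by ring

lemma transSum_poissonTilt (M : MDP S A) (x : S) (a : A) (y : S) (lam : ℝ)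
    (D : List (Episode S A)) :
    transSum (poissonTilt M x a y lam) D = lam * countTrans D x a y
      - countPair D x a * ((M.P x a y).toReal * (Real.exp lam - 1)) := by
  rw [poissonTilt, transSum_pairFun, countPair, Nat.cast_sum]
  simp [Finset.sum_mul, mul_sub, Finset.sum_sub_distrib]
  ring

/-- The indices of the tilting functions used in the analysis. -/
abbrev TiltIndex (S A : Type*) (H T : ℕ) := (S × A × Fin H × Fin T × Bool) ⊕ (S × A × S)

/-- The tilting functions used in the analysis. -/
def tilt (M : MDP S A) (T : ℕ) (l lam : ℝ) : TiltIndex S A M.H T → Transition S A → ℝ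
  | Sum.inl (x, a, j, n, b) => hoeffdingTilt M x a (optVal M j)
      ((if b then 1 else -1) * (√(2 * l) / (M.H * √((n : ℝ) + 1))))
  | Sum.inr (x, a, y) => poissonTilt M x a y lam

/-- The empirical means are close to the true means. -/
def Concentrated (M : MDP S A) (T : ℕ) (l lam : ℝ) (D : List (Episode S A)) : Prop :=
  ∀ i, transSum (tilt M T l lam i) D ≤ l

/-- Concentration holds after every episode. -/
def AlwaysConcentrated (M : MDP S A) (T : ℕ) (l lam : ℝ) : List (Episode S A) → Prop
  | [] => True
  | e :: D => Concentrated M T l lam (e :: D) ∧ AlwaysConcentrated M T l lam D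

lemma AlwaysConcentrated.concentrated {M : MDP S A} {T : ℕ} {l lam : ℝ} (hl : 0 ≤ l)
    {D : List (Episode S A)} (h : AlwaysConcentrated M T l lam D) :
    Concentrated M T l lam D := by
  cases D with
  | nil => intro i; simpa [transSum] using hl
  | cons e D => exact h.1

lemma sum_empP_mul (D : List (Episode S A)) (x : S) (a : A) (f : S → ℝ) :
    ∑ y, empP D x a y * f y = (∑ y, (countTrans D x a y : ℝ) * f y) / countPair D x a := by
  rw [Finset.sum_div]
  exact Finset.sum_congr rfl fun y _ => by rw [empP]; ring

/-- The tilt s = ±√(2l)/(H√N) is the optimal one for exactly N visits: it makes the compensator N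
s²H²/2 equal to l. Having a tilt for each count up to T lets N be random. -/
lemma Concentrated.abs_sub_le {M : MDP S A} {T : ℕ} {l lam : ℝ} {D : List (Episode S A)}
    (h : Concentrated M T l lam D) (hl : 0 < l) {x : S} {a : A} (hN : 0 < countPair D x a)
    (hT : countPair D x a ≤ T) {j : ℕ} (hj : j < M.H) :
    |∑ y, empP D x a y * optVal M j y - mean (M.P x a) (optVal M j)|
      ≤ M.H * √(2 * l) / √(countPair D x a) := by
  set N := countPair D x a with hNdef
  set f := optVal M j
  set q := ∑ y, (countTrans D x a y : ℝ) * f y with hq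
  have hH : (0 : ℝ) < M.H := by exact_mod_cast (Nat.zero_le j).trans_lt hj
  have hN' : (0 : ℝ) < N := by exact_mod_cast hN
  have key : ∀ b : Bool, (if b then 1 else -1) * (q - N * mean (M.P x a) f)
      ≤ M.H * √(2 * l) * √N := by
    intro b
    -- Index n of a tilt stands for n + 1 visits.
    have := h (Sum.inl (x, a, ⟨j, hj⟩, ⟨N - 1, by omega⟩, b))
    rw [tilt, transSum_hoeffdingTilt] at this
    have hcast : (((N - 1 : ℕ) : ℝ) + 1) = N := by
      rw [← Nat.cast_succ]
      congr 1
      omega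
    simp only [← hNdef, hcast] at this
    set r := √(2 * l) with hr
    have hr0 : 0 < r := Real.sqrt_pos.2 (by linarith)
    have hr2 : r ^ 2 = 2 * l := Real.sq_sqrt (by linarith)
    set w := √(N : ℝ) with hw
    have hw0 : 0 < w := Real.sqrt_pos.2 hN'
    have hw2 : (N : ℝ) = w ^ 2 := (Real.sq_sqrt hN'.le).symm
    set σ : ℝ := if b then 1 else -1 with hσ
    have hσ2 : σ ^ 2 = 1 := by rw [hσ]; split_ifs <;> norm_num
    have h2 : (N : ℝ) * ((σ * (r / (M.H * w))) ^ 2 * (M.H : ℝ) ^ 2 / 2) = r ^ 2 / 2 := by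
      rw [mul_pow, hσ2, hw2]
      field_simp
    rw [h2] at this
    have h3 : σ * (r / (M.H * w)) * (q - N * mean (M.P x a) f) ≤ r ^ 2 := by
      have : l = r ^ 2 / 2 := by linarith
      linarith
    have h4 : σ * (q - N * mean (M.P x a) f) * r ≤ (M.H * r * w) * r := by
      have := mul_le_mul_of_nonneg_left h3 (mul_nonneg hH.le hw0.le)
      calc _ = M.H * w * (σ * (r / (M.H * w)) * (q - N * mean (M.P x a) f)) := by
            field_simp
        _ ≤ _ := this.trans_eq (by ring)
    exact le_of_mul_le_mul_right h4 hr0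
  rw [sum_empP_mul, ← hNdef, ← hq]
  have e : q / N - mean (M.P x a) f = (q - N * mean (M.P x a) f) / N := by
    field_simp
  have e2 : M.H * √(2 * l) / √(N : ℝ) = M.H * √(2 * l) * √N / N := by
    rw [div_eq_div_iff (Real.sqrt_pos.2 hN').ne' hN'.ne', mul_assoc _ (√(N : ℝ)),
      Real.mul_self_sqrt hN'.le]
  rw [e, e2, abs_div, abs_of_pos hN']
  refine div_le_div_of_nonneg_right (abs_le'.2 ⟨?_, ?_⟩) hN'.le
  · simpa using key true
  · simpa using key false

lemma Concentrated.empP_le {M : MDP S A} {T : ℕ} {l lam : ℝ} {D : List (Episode S A)}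
    (h : Concentrated M T l lam D) (hlam : 0 < lam) (hlam1 : lam ≤ 1) {x : S} {a : A}
    (hN : 0 < countPair D x a) (y : S) :
    empP D x a y ≤ (1 + lam) * (M.P x a y).toReal + l / (lam * countPair D x a) := by
  have := h (Sum.inr (x, a, y))
  rw [tilt, transSum_poissonTilt] at this
  have hN' : (0 : ℝ) < countPair D x a := by exact_mod_cast hN
  have hp : 0 ≤ (M.P x a y).toReal := ENNReal.toReal_nonneg
  -- The estimate e^λ ≤ 1 + λ + λ² for λ ≤ 1; dividing by λ produces the multiplicative factor 1 +
  -- λ.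
  have he : Real.exp lam - 1 ≤ lam * (1 + lam) := by
    have := Real.abs_exp_sub_one_sub_id_le (x := lam) (by rw [abs_of_pos hlam]; exact hlam1)
    have := (abs_le.1 this).2
    linarith
  have h1 := mul_le_mul_of_nonneg_left he (mul_nonneg hN'.le hp)
  rw [empP, div_le_iff₀ hN']
  have h2 : lam * countTrans D x a y ≤
      lam * (((1 + lam) * (M.P x a y).toReal + l / (lam * countPair D x a)) * countPair D x a) := by
    have : lam * (((1 + lam) * (M.P x a y).toReal + l / (lam * countPair D x a))
        * countPair D x a) = countPair D x a * (M.P x a y).toReal * (lam * (1 + lam)) + l := by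
      field_simp
    rw [this]
    linarith
  exact le_of_mul_le_mul_left h2 hlam

variable [Fintype A]

-- Markov's inequality for each tilt, at level e^l, and a union bound over the tilts.
open Classical in
lemma ev_not_concentrated_le [Nonempty A] (M : MDP S A) (init : List (Episode S A) → PMF S)
    (learner : List (Episode S A) → Policy S A) (T : ℕ) (l lam : ℝ) (k : ℕ) :
    ev (interaction M init learner k)
      ({D | ¬ Concentrated M T l lam D}.indicator 1) ≤
      Fintype.card (TiltIndex S A M.H T) * ENNReal.ofReal (Real.exp (-l)) := by
  have h1 : ∀ i, ev (interaction M init learner k)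
      (fun D => ENNReal.ofReal (Real.exp (transSum (tilt M T l lam i) D))) ≤ 1 := by
    intro i
    refine ev_exp_transSum_le M init learner _ ?_ k
    rcases i with ⟨x, a, j, n, b⟩ | ⟨x, a, y⟩
    · refine mean_exp_hoeffdingTilt_le M x a _ _ (optVal_nonneg M j) fun y => ?_
      exact (optVal_le M j y).trans (by exact_mod_cast j.2.le)
    · exact mean_exp_poissonTilt_le M x a y lam
  calc _ ≤ ev (interaction M init learner k) (fun D => ∑ i,
        ENNReal.ofReal (Real.exp (-l)) *
          ENNReal.ofReal (Real.exp (transSum (tilt M T l lam i) D))) := by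
        refine ev_mono _ fun D _ => ?_
        by_cases hD : Concentrated M T l lam D
        · simp [hD]
        · rw [Set.indicator_of_mem (by exact hD)]
          simp only [Concentrated, not_forall, not_le] at hD
          obtain ⟨i, hi⟩ := hD
          refine le_trans ?_ (Finset.single_le_sum (fun _ _ => zero_le) (Finset.mem_univ i))
          rw [← ENNReal.ofReal_mul (Real.exp_nonneg _), ← Real.exp_add, Pi.one_apply,
            ENNReal.one_le_ofReal, Real.one_le_exp_iff]
          linarith
    _ ≤ ∑ _i : TiltIndex S A M.H T, ENNReal.ofReal (Real.exp (-l)) := by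
        rw [ev_sum]
        refine Finset.sum_le_sum fun i _ => ?_
        rw [ev_const_mul]
        exact mul_le_of_le_one_right' (h1 i)
    _ = _ := by rw [Finset.sum_const, Finset.card_univ, nsmul_eq_mul]

-- Union bound over episodes. Empty data costs nothing, so there are exactly k terms.
open Classical in
lemma ev_not_alwaysConcentrated_le [Nonempty A] (M : MDP S A)
    (init : List (Episode S A) → PMF S)
    (learner : List (Episode S A) → Policy S A) (T : ℕ) (l lam : ℝ) (k : ℕ) :
    ev (interaction M init learner k)
      ({D | ¬ AlwaysConcentrated M T l lam D}.indicator 1) ≤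
      k * (Fintype.card (TiltIndex S A M.H T) * ENNReal.ofReal (Real.exp (-l))) := by
  induction k with
  | zero => simp [interaction, ev_pure, AlwaysConcentrated]
  | succ k ih =>
    have h1 := ev_not_concentrated_le M init learner T l lam (k + 1)
    rw [ev_interaction_succ] at h1 ⊢
    rw [Nat.cast_succ, add_mul, one_mul, add_comm (_ * _)]
    refine le_trans ?_ (add_le_add h1 ih)
    rw [← ev_add]
    refine ev_mono _ fun D _ => ?_
    rw [← ev_const (init D) (Set.indicator _ _ D), ← ev_add]
    refine ev_mono _ fun x _ => ?_
    rw [← ev_const (M.rollout (learner D) M.H 1 x) (Set.indicator _ _ D), ← ev_add]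
    refine ev_mono _ fun τ _ => ?_
    by_cases h2 : Concentrated M T l lam ((x, τ) :: D) <;>
      by_cases h3 : AlwaysConcentrated M T l lam D <;>
      simp [AlwaysConcentrated, h2, h3]

end Supermartingale

/-! ### Optimism and the recursion for the gap. -/

section Optimism

variable {S A : Type*} [DecidableEq S] [DecidableEq A]

lemma countTrans_cons (e : Episode S A) (D : List (Episode S A)) (x : S) (a : A) (y : S) :
    countTrans (e :: D) x a y = e.2.count (x, a, y) + countTrans D x a y := by
  simp [countTrans]

variable [Fintype S]

lemma countPair_cons (e : Episode S A) (D : List (Episode S A)) (x : S) (a : A) :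
    countPair (e :: D) x a = ∑ y, e.2.count (x, a, y) + countPair D x a := by
  simp [countPair, countTrans_cons, Finset.sum_add_distrib]

lemma countPair_nil (x : S) (a : A) : countPair ([] : List (Episode S A)) x a = 0 := by
  simp [countPair, countTrans]

lemma empP_nonneg (D : List (Episode S A)) (x : S) (a : A) (y : S) : 0 ≤ empP D x a y := by
  unfold empP; positivity

variable [Fintype A]

/-- The optimistic value function with `n` steps to go. -/
def maxQ (M : MDP S A) (K : ℕ) (δ : ℝ) (D : List (Episode S A)) (n : ℕ) (x : S) : ℝ :=
  ⨆ b, ucbQToGo M K δ D n x b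

variable (M : MDP S A) (K : ℕ) (δ : ℝ)

lemma ucbQToGo_zero (D : List (Episode S A)) (x : S) (a : A) : ucbQToGo M K δ D 0 x a = 0 := by
  cases D <;> rw [ucbQToGo, ucbStep]

lemma ucbQToGo_succ_cons (e : Episode S A) (D : List (Episode S A)) (n : ℕ) (x : S) (a : A) :
    ucbQToGo M K δ (e :: D) (n + 1) x a = if 0 < countPair (e :: D) x a then
      min (ucbQToGo M K δ D (n + 1) x a) (min (M.H : ℝ)
        (M.R x a + ∑ y, empP (e :: D) x a y * maxQ M K δ (e :: D) n y
          + bonusCH M K δ (e :: D) x a)) else (M.H : ℝ) := by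
  simp only [maxQ, ucbQToGo]
  rw [ucbStep]

lemma ucbQToGo_succ_of_countPair_eq_zero (D : List (Episode S A)) (n : ℕ) (x : S) (a : A)
    (h : countPair D x a = 0) : ucbQToGo M K δ D (n + 1) x a = M.H := by
  cases D with
  | nil => rw [ucbQToGo, ucbStep, if_neg (by simp [h])]
  | cons e D => rw [ucbQToGo_succ_cons, if_neg (by simp [h])]

lemma ucbQToGo_le (D : List (Episode S A)) (n : ℕ) (x : S) (a : A) :
    ucbQToGo M K δ D n x a ≤ M.H := by
  cases n with
  | zero => rw [ucbQToGo_zero]; positivity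
  | succ n =>
    by_cases h : 0 < countPair D x a
    · cases D with
      | nil => simp [countPair_nil] at h
      | cons e D =>
        rw [ucbQToGo_succ_cons, if_pos h]
        exact (min_le_right _ _).trans (min_le_left _ _)
    · exact (ucbQToGo_succ_of_countPair_eq_zero M K δ D n x a (by omega)).le

lemma ucbQToGo_succ_le (D : List (Episode S A)) (n : ℕ) (x : S) (a : A)
    (h : 0 < countPair D x a) : ucbQToGo M K δ D (n + 1) x a ≤
      M.R x a + ∑ y, empP D x a y * maxQ M K δ D n y + bonusCH M K δ D x a := by
  cases D with
  | nil => simp [countPair_nil] at h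
  | cons e D =>
    rw [ucbQToGo_succ_cons, if_pos h]
    exact (min_le_right _ _).trans (min_le_right _ _)

lemma ucbQToGo_le_maxQ (D : List (Episode S A)) (n : ℕ) (x : S) (a : A) :
    ucbQToGo M K δ D n x a ≤ maxQ M K δ D n x :=
  le_ciSup (Set.finite_range _).bddAbove a

lemma maxQ_le [Nonempty A] (D : List (Episode S A)) (n : ℕ) (x : S) :
    maxQ M K δ D n x ≤ M.H :=
  ciSup_le fun a => ucbQToGo_le M K δ D n x a

/-- The logarithmic factor in the bonus. -/
def bonusLog : ℝ :=
  Real.log (5 * Fintype.card S * Fintype.card A * ((K : ℝ) * M.H) / δ)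

lemma bonusCH_eq (D : List (Episode S A)) (x : S) (a : A) :
    bonusCH M K δ D x a = 7 * M.H * bonusLog M K δ / √(countPair D x a) := by
  rw [bonusCH, bonusLog, one_div, Real.sqrt_inv, div_eq_mul_inv (7 * _ * _)]

variable {M K δ}

lemma optVal_le_maxQ_of_forall [Nonempty A] {D : List (Episode S A)}
    (h : ∀ n < M.H, ∀ x a,
      M.R x a + mean (M.P x a) (optVal M n) ≤ ucbQToGo M K δ D (n + 1) x a)
    {n : ℕ} (hn : n ≤ M.H) (x : S) : optVal M n x ≤ maxQ M K δ D n x := by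
  cases n with
  | zero => simp [optVal, maxQ, ucbQToGo_zero]
  | succ n => exact ciSup_le fun a => (h n hn x a).trans (ucbQToGo_le_maxQ M K δ D _ x a)

/-- Double induction: over the data because of the minimum with the previous Q-values, which is why
concentration is required after every past episode, and over the steps to go for the Bellman backup.
The hypothesis `hb` says that the bonus covers the Hoeffding error. -/
lemma add_mean_optVal_le_ucbQToGo [Nonempty A] {T : ℕ} {l lam : ℝ} (hl : 0 < l)
    (hb : √(2 * l) ≤ 7 * bonusLog M K δ) (D : List (Episode S A)) :
    AlwaysConcentrated M T l lam D → (∀ x a, countPair D x a ≤ T) → ∀ n < M.H, ∀ x a,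
      M.R x a + mean (M.P x a) (optVal M n) ≤ ucbQToGo M K δ D (n + 1) x a := by
  have hle : ∀ n < M.H, ∀ x a, M.R x a + mean (M.P x a) (optVal M n) ≤ M.H := by
    intro n hn x a
    refine (le_optVal_succ M n x a).trans ((optVal_le M _ x).trans ?_)
    exact_mod_cast hn
  induction D with
  | nil =>
    intro _ _ n hn x a
    rw [ucbQToGo_succ_of_countPair_eq_zero _ _ _ _ _ _ _ (countPair_nil x a)]
    exact hle n hn x a
  | cons e D ihD =>
    intro hC hT n
    have ihD' := ihD hC.2 fun x a => le_trans (by rw [countPair_cons]; omega) (hT x a)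
    induction n using Nat.strong_induction_on with
    | _ n ih =>
      intro hn x a
      by_cases hN : 0 < countPair (e :: D) x a
      · rw [ucbQToGo_succ_cons, if_pos hN]
        refine le_min (ihD' n hn x a) (le_min (hle n hn x a) ?_)
        have hopt : ∀ y, optVal M n y ≤ maxQ M K δ (e :: D) n y := by
          intro y
          cases n with
          | zero => simp [optVal, maxQ, ucbQToGo_zero]
          | succ m =>
            exact ciSup_le fun b => (ih m (by omega) (by omega) y b).trans
              (ucbQToGo_le_maxQ M K δ _ _ y b)
        have h1 := (abs_le.1 (hC.1.abs_sub_le hl hN (hT x a) hn)).1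
        have h2 : ∑ y, empP (e :: D) x a y * optVal M n y
            ≤ ∑ y, empP (e :: D) x a y * maxQ M K δ (e :: D) n y :=
          Finset.sum_le_sum fun y _ => mul_le_mul_of_nonneg_left (hopt y) (empP_nonneg _ _ _ _)
        have h3 : M.H * √(2 * l) / √(countPair (e :: D) x a) ≤ bonusCH M K δ (e :: D) x a := by
          rw [bonusCH_eq]
          refine div_le_div_of_nonneg_right ?_ (Real.sqrt_nonneg _)
          calc M.H * √(2 * l) ≤ M.H * (7 * bonusLog M K δ) :=
                mul_le_mul_of_nonneg_left hb (Nat.cast_nonneg _)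
            _ = _ := by ring
        linarith
      · rw [ucbQToGo_succ_of_countPair_eq_zero _ _ _ _ _ _ _ (by omega)]
        exact hle n hn x a

/-- The gap between the optimistic value and the value of the policy `π`. -/
def gap (M : MDP S A) (K : ℕ) (δ : ℝ) (D : List (Episode S A)) (π : Policy S A) (n : ℕ)
    (x : S) : ℝ :=
  maxQ M K δ D n x - polVal M π n (M.H + 1 - n) x

/-- The error allowance after `N` visits of a state-action pair. -/
def stepError (H : ℕ) (c₁ c₂ : ℝ) (N : ℕ) : ℝ :=
  (if N < H then (H : ℝ) else 0) + c₁ / √(max N H : ℕ) + c₂ / (max N H : ℕ)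

/-- The greedy action turns the gap into bonus plus model error plus mean next gap. The model error
at V* is a second bonus-sized term; at V - V* it is split entrywise, using 0 ≤ V - V* ≤ min(gap, H).
-/
lemma gap_succ_le [Nonempty A] {T : ℕ} {l lam : ℝ} (hl : 0 < l) (hlam : 0 < lam)
    (hlam1 : lam ≤ 1) (hb : √(2 * l) ≤ 7 * bonusLog M K δ) {D : List (Episode S A)}
    (hC : AlwaysConcentrated M T l lam D) (hT : ∀ x a, countPair D x a ≤ T)
    {π : Policy S A} {n : ℕ} (hn : n < M.H) (x : S)
    (hπ : ∀ a, ucbQToGo M K δ D (n + 1) x a ≤ ucbQToGo M K δ D (n + 1) x (π (M.H - n) x)) :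
    gap M K δ D π (n + 1) x ≤
      stepError M.H (M.H * (7 * bonusLog M K δ + √(2 * l)))
        (Fintype.card S * (M.H * l / lam)) (countPair D x (π (M.H - n) x)) +
      (1 + lam) * mean (M.P x (π (M.H - n) x)) (gap M K δ D π n) := by
  have hopt := fun y => optVal_le_maxQ_of_forall (add_mean_optVal_le_ucbQToGo hl hb D hC hT) hn.le y
  have hpol := fun y => polVal_le_optVal M π n (M.H + 1 - n) y
  have hmax : maxQ M K δ D (n + 1) x = ucbQToGo M K δ D (n + 1) x (π (M.H - n) x) :=
    le_antisymm (ciSup_le hπ) (ucbQToGo_le_maxQ _ _ _ _ _ _ _)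
  set a := π (M.H - n) x with ha
  have hH : (0 : ℝ) < M.H := by exact_mod_cast (Nat.zero_le n).trans_lt hn
  have hgap : ∀ y, 0 ≤ gap M K δ D π n y := fun y => sub_nonneg.2 ((hpol y).trans (hopt y))
  have hmean : 0 ≤ (1 + lam) * mean (M.P x a) (gap M K δ D π n) :=
    mul_nonneg (by linarith) (mean_nonneg _ hgap)
  have hbon : 0 ≤ bonusLog M K δ := by linarith [Real.sqrt_nonneg (2 * l)]
  have hc1 : 0 ≤ M.H * (7 * bonusLog M K δ + √(2 * l)) := by positivity
  have hc2 : 0 ≤ Fintype.card S * (M.H * l / lam) := by positivity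
  have hpoleq : polVal M π (n + 1) (M.H + 1 - (n + 1)) x
      = M.R x a + mean (M.P x a) (polVal M π n (M.H + 1 - n)) := by
    rw [polVal, show M.H + 1 - (n + 1) = M.H - n by omega, ← ha,
      show M.H - n + 1 = M.H + 1 - n by omega]
  rw [stepError]
  split_ifs with hlt
  -- A pair with fewer than H visits is charged the trivial bound H; this includes unvisited pairs.
  · have h1 : gap M K δ D π (n + 1) x ≤ M.H := by
      have h2 := maxQ_le M K δ D (n + 1) x
      have h3 := polVal_nonneg M π (n + 1) (M.H + 1 - (n + 1)) x
      unfold gap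
      linarith
    have h4 : 0 ≤ M.H * (7 * bonusLog M K δ + √(2 * l)) / √(max (countPair D x a) M.H : ℕ) := by
      positivity
    have h5 : 0 ≤ Fintype.card S * (M.H * l / lam) / (max (countPair D x a) M.H : ℕ) := by
      positivity
    linarith
  · push Not at hlt
    have hN' : (0 : ℝ) < countPair D x a := hH.trans_le (by exact_mod_cast hlt)
    have hN : 0 < countPair D x a := by exact_mod_cast hN'
    rw [max_eq_left hlt]
    have hC0 := hC.concentrated hl.le
    have h1 := ucbQToGo_succ_le M K δ D n x a hN
    have h2 := (abs_le.1 (hC0.abs_sub_le hl hN (hT x a) hn)).2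
    have h3 : ∑ y, (empP D x a y - (M.P x a y).toReal) * (maxQ M K δ D n y - optVal M n y)
        ≤ lam * mean (M.P x a) (gap M K δ D π n)
          + Fintype.card S * (M.H * l / lam) / countPair D x a := by
      calc _ ≤ ∑ y, (lam * ((M.P x a y).toReal * gap M K δ D π n y)
            + M.H * l / lam / countPair D x a) := by
            refine Finset.sum_le_sum fun y _ => ?_
            have hp : 0 ≤ (M.P x a y).toReal := ENNReal.toReal_nonneg
            have hd : 0 ≤ maxQ M K δ D n y - optVal M n y := sub_nonneg.2 (hopt y)
            have hdH : maxQ M K δ D n y - optVal M n y ≤ M.H := by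
              linarith [maxQ_le M K δ D n y, optVal_nonneg M n y]
            have hdg : maxQ M K δ D n y - optVal M n y ≤ gap M K δ D π n y := by
              unfold gap; linarith [hpol y]
            have he := hC0.empP_le hlam hlam1 hN y
            have hq : 0 ≤ l / (lam * countPair D x a) := by positivity
            calc _ ≤ (lam * (M.P x a y).toReal + l / (lam * countPair D x a)) *
                  (maxQ M K δ D n y - optVal M n y) :=
                  mul_le_mul_of_nonneg_right (by linarith) hd
              _ ≤ lam * (M.P x a y).toReal * gap M K δ D π n y
                  + l / (lam * countPair D x a) * M.H := by
                  rw [add_mul]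
                  exact add_le_add (mul_le_mul_of_nonneg_left hdg (by positivity))
                    (mul_le_mul_of_nonneg_left hdH hq)
              _ = _ := by field_simp
        _ = _ := by
            rw [Finset.sum_add_distrib, ← Finset.mul_sum, mean, Finset.sum_const,
              Finset.card_univ, nsmul_eq_mul]
            ring
    -- Expanding the correction term isolates the part (P̂ - P)V*, which `h2` controls.
    have h4 : ∑ y, (empP D x a y - (M.P x a y).toReal) * (maxQ M K δ D n y - optVal M n y)
        = ∑ y, empP D x a y * maxQ M K δ D n y - ∑ y, empP D x a y * optVal M n y
          - mean (M.P x a) (maxQ M K δ D n) + mean (M.P x a) (optVal M n) := by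
      simp only [mean, ← Finset.sum_sub_distrib, ← Finset.sum_add_distrib]
      exact Finset.sum_congr rfl fun y _ => by ring
    have h5 : mean (M.P x a) (gap M K δ D π n) = mean (M.P x a) (maxQ M K δ D n)
        - mean (M.P x a) (polVal M π n (M.H + 1 - n)) := mean_sub _ _ _
    have h6 : M.H * (7 * bonusLog M K δ + √(2 * l)) / √(countPair D x a)
        = bonusCH M K δ D x a + M.H * √(2 * l) / √(countPair D x a) := by
      rw [bonusCH_eq]
      ring
    have h7 : gap M K δ D π (n + 1) x = ucbQToGo M K δ D (n + 1) x a
        - (M.R x a + mean (M.P x a) (polVal M π n (M.H + 1 - n))) := by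
      rw [gap, hmax, hpoleq]
    rw [h7, h6, one_add_mul]
    linarith

lemma gap_mem_Icc [Nonempty A] {T : ℕ} {l lam : ℝ} (hl : 0 < l)
    (hb : √(2 * l) ≤ 7 * bonusLog M K δ) {D : List (Episode S A)}
    (hC : AlwaysConcentrated M T l lam D) (hT : ∀ x a, countPair D x a ≤ T)
    (π : Policy S A) {n : ℕ} (hn : n ≤ M.H) (x : S) :
    gap M K δ D π n x ∈ Set.Icc (0 : ℝ) M.H := by
  have hopt := optVal_le_maxQ_of_forall (add_mean_optVal_le_ucbQToGo hl hb D hC hT) hn x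
  have hpol := polVal_le_optVal M π n (M.H + 1 - n) x
  have h1 := polVal_nonneg M π n (M.H + 1 - n) x
  have h2 := maxQ_le M K δ D n x
  constructor <;> unfold gap <;> linarith

end Optimism

/-! ### Sums of the error allowance over visit counts. -/

section Sums

/-- For j < 2H the argument is the constant H; beyond that it runs through H, H + 1, …. -/
lemma sum_range_max_le (φ : ℕ → ℝ) (hφ : ∀ n, 0 ≤ φ n) (H N : ℕ) :
    ∑ j ∈ Finset.range N, φ (max (j - H) H) ≤
      2 * H * φ H + ∑ i ∈ Finset.range (N - 2 * H), φ (H + i) := by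
  have h1 : ∑ j ∈ Finset.range N, φ (max (j - H) H)
      ≤ ∑ j ∈ Finset.range (2 * H + (N - 2 * H)), φ (max (j - H) H) :=
    Finset.sum_le_sum_of_subset_of_nonneg
      (Finset.range_subset_range.2 (by omega)) fun _ _ _ => hφ _
  refine h1.trans ?_
  rw [Finset.sum_range_add]
  refine add_le_add (le_of_eq ?_) (Finset.sum_le_sum fun i _ => le_of_eq ?_)
  · rw [Finset.sum_congr rfl (g := fun _ => φ H), Finset.sum_const, Finset.card_range,
      nsmul_eq_mul]
    · push_cast; ring
    · intro j hj
      rw [Finset.mem_range] at hj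
      rw [max_eq_right (by omega)]
  · congr 1
    omega

lemma sum_range_inv_sqrt_le (H : ℕ) (hH : 0 < H) (n : ℕ) :
    ∑ i ∈ Finset.range n, 1 / √((H + i : ℕ) : ℝ) ≤ 2 * √((H : ℝ) + n - 1) := by
  induction n with
  | zero => simp
  | succ n ih =>
    rw [Finset.sum_range_succ]
    have hH' : (1 : ℝ) ≤ H := by exact_mod_cast hH
    have hm : (0 : ℝ) < H + n := by positivity
    push_cast at ih ⊢
    rw [show (H : ℝ) + (n + 1) - 1 = H + n by ring]
    set u := √((H : ℝ) + n - 1)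
    set v := √((H : ℝ) + n)
    have hv : 0 < v := Real.sqrt_pos.2 hm
    have hu2 : u ^ 2 = H + n - 1 :=
      Real.sq_sqrt (by linarith [Nat.cast_nonneg (α := ℝ) n])
    have hv2 : v ^ 2 = H + n := Real.sq_sqrt hm.le
    -- Telescoping: v² - u² = 1, so the claim amounts to (v - u)² ≥ 0.
    have h1 : 1 / v ≤ 2 * v - 2 * u := by
      rw [div_le_iff₀ hv]
      nlinarith [sq_nonneg (u - v)]
    linarith

lemma sum_range_inv_le (H : ℕ) (hH : 0 < H) (n : ℕ) :
    ∑ i ∈ Finset.range (n + 1), 1 / ((H + i : ℕ) : ℝ) ≤ 1 + Real.log (H + n) := by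
  have hH' : (1 : ℝ) ≤ H := by exact_mod_cast hH
  induction n with
  | zero =>
    simp only [zero_add, Finset.range_one, Finset.sum_singleton, add_zero, Nat.cast_zero]
    have h1 : 1 / (H : ℝ) ≤ 1 := by rw [div_le_one (by linarith)]; exact hH'
    linarith [Real.log_nonneg hH']
  | succ n ih =>
    rw [Finset.sum_range_succ]
    push_cast at ih ⊢
    have hm : (0 : ℝ) < H + n := by positivity
    have h1 := Real.one_sub_inv_le_log_of_pos (x := ((H : ℝ) + (n + 1)) / (H + n))
      (by positivity)
    rw [Real.log_div (by positivity) hm.ne', inv_div] at h1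
    have h2 : 1 - ((H : ℝ) + n) / (H + (n + 1)) = 1 / (H + (n + 1)) := by
      field_simp
      ring
    linarith

lemma stepError_nonneg {H : ℕ} {c₁ c₂ : ℝ} (h₁ : 0 ≤ c₁) (h₂ : 0 ≤ c₂) (N : ℕ) :
    0 ≤ stepError H c₁ c₂ N := by
  unfold stepError
  have : (0 : ℝ) ≤ if N < H then (H : ℝ) else 0 := by split_ifs <;> positivity
  positivity

lemma stepError_antitone {H : ℕ} (hH : 0 < H) {c₁ c₂ : ℝ} (h₁ : 0 ≤ c₁) (h₂ : 0 ≤ c₂) :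
    Antitone (stepError H c₁ c₂) := by
  intro m n hmn
  unfold stepError
  have hm : (0 : ℝ) < (max m H : ℕ) := by
    exact_mod_cast lt_of_lt_of_le hH (le_max_right m H)
  have hle : ((max m H : ℕ) : ℝ) ≤ (max n H : ℕ) := by
    exact_mod_cast max_le_max hmn le_rfl
  have h3 : (if n < H then (H : ℝ) else 0) ≤ if m < H then (H : ℝ) else 0 := by
    split_ifs <;> first | positivity | omega | exact le_rfl
  gcongr

/-- The shift j - H accounts for counts being frozen during an episode: at the visit numbered j, the
count at the start of the episode is at least j - H. The first 2H visits cost 2H² + 2c₁√H + 2c₂;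
later ones are compared with integrals. -/
lemma sum_stepError_le {H : ℕ} (hH : 0 < H) {c₁ c₂ : ℝ} (h₁ : 0 ≤ c₁) (h₂ : 0 ≤ c₂)
    {N T : ℕ} (hNT : N ≤ T) (hT : 0 < T) :
    ∑ j ∈ Finset.range N, stepError H c₁ c₂ (j - H) ≤
      2 * (H : ℝ) ^ 2 + c₁ * (2 * √H + 2 * √N) + c₂ * (3 + Real.log T) := by
  have hH' : (0 : ℝ) < H := by exact_mod_cast hH
  simp only [stepError, Finset.sum_add_distrib]
  refine add_le_add (add_le_add ?_ ?_) ?_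
  · calc ∑ j ∈ Finset.range N, (if j - H < H then (H : ℝ) else 0)
        = ((Finset.range N).filter fun j => j - H < H).card * (H : ℝ) := by
          rw [← Finset.sum_filter, Finset.sum_const, nsmul_eq_mul]
      _ ≤ (2 * H : ℕ) * (H : ℝ) := by
          refine mul_le_mul_of_nonneg_right ?_ hH'.le
          have : ((Finset.range N).filter fun j => j - H < H) ⊆ Finset.range (2 * H) := by
            intro j hj
            simp only [Finset.mem_filter, Finset.mem_range] at hj ⊢
            omega
          have := Finset.card_le_card this
          rw [Finset.card_range] at this
          exact_mod_cast this
      _ = _ := by push_cast; ring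
  · have h := sum_range_max_le (fun n => 1 / √(n : ℝ)) (fun n => by positivity) H N
    have e : ∑ j ∈ Finset.range N, c₁ / √((max (j - H) H : ℕ) : ℝ)
        = c₁ * ∑ j ∈ Finset.range N, 1 / √((max (j - H) H : ℕ) : ℝ) := by
      rw [Finset.mul_sum]
      exact Finset.sum_congr rfl fun j _ => by ring
    rw [e]
    refine mul_le_mul_of_nonneg_left (h.trans (add_le_add ?_ ?_)) h₁
    · rw [mul_assoc, mul_one_div, Real.div_sqrt]
    · rcases Nat.eq_zero_or_pos (N - 2 * H) with h0 | h0
      · rw [h0]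
        simp
      · refine (sum_range_inv_sqrt_le H hH _).trans ?_
        gcongr
        have : ((H + (N - 2 * H) : ℕ) : ℝ) ≤ N := by exact_mod_cast (by omega)
        push_cast at this ⊢
        linarith
  · have h := sum_range_max_le (fun n => 1 / (n : ℝ)) (fun n => by positivity) H N
    have e : ∑ j ∈ Finset.range N, c₂ / ((max (j - H) H : ℕ) : ℝ)
        = c₂ * ∑ j ∈ Finset.range N, 1 / ((max (j - H) H : ℕ) : ℝ) := by
      rw [Finset.mul_sum]
      exact Finset.sum_congr rfl fun j _ => by ring
    rw [e]
    refine mul_le_mul_of_nonneg_left (h.trans ?_) h₂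
    have h2 : 2 * (H : ℝ) * (1 / H) = 2 := by field_simp
    have hT' : (1 : ℝ) ≤ T := by exact_mod_cast hT
    rw [h2]
    rcases Nat.eq_zero_or_pos (N - 2 * H) with h0 | h0
    · rw [h0]
      simp only [Finset.range_zero, Finset.sum_empty]
      linarith [Real.log_nonneg hT']
    · obtain ⟨m, hm⟩ := Nat.exists_eq_add_of_lt h0
      rw [zero_add] at hm
      rw [hm]
      have h3 := sum_range_inv_le H hH m
      have h4 : Real.log (H + m) ≤ Real.log T := by
        refine Real.log_le_log (by positivity) ?_
        exact_mod_cast (by omega : H + m ≤ T)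
      linarith

end Sums

/-! ### Unrolling the recursion along a trajectory, and counting visits. -/

section Path

variable {S A : Type*}

/-- The sum of `β` along a list of transitions, the `i`-th term being weighted by `ρ ^ i`. -/
def weightedSum (β : S → A → ℝ) (ρ : ℝ) : List (Transition S A) → ℝ
  | [] => 0
  | t :: τ => β t.1 t.2.1 + ρ * weightedSum β ρ τ

lemma weightedSum_le {β : S → A → ℝ} (hβ : ∀ x a, 0 ≤ β x a) {ρ : ℝ} (hρ : 1 ≤ ρ)
    (τ : List (Transition S A)) :
    weightedSum β ρ τ ≤ ρ ^ τ.length * (τ.map fun t => β t.1 t.2.1).sum := by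
  induction τ with
  | nil => simp [weightedSum]
  | cons t τ ih =>
    rw [weightedSum, List.length_cons, List.map_cons, List.sum_cons, mul_add]
    refine add_le_add (le_mul_of_one_le_left (hβ _ _) (one_le_pow₀ hρ)) ?_
    rw [pow_succ', mul_assoc]
    exact mul_le_mul_of_nonneg_left ih (by linarith)

/-- Concentration of the discrepancy between the mean and the realization of a quantity that
satisfies a recursive inequality along the rollout. -/
lemma ev_exp_sub_weightedSum_le [Fintype S] (M : MDP S A) (π : Policy S A) (G : ℕ → S → ℝ)
    (β : S → A → ℝ) {ρ : ℝ} (hρ : 1 ≤ ρ) (hzero : ∀ x, G 0 x = 0)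
    (hG : ∀ n ≤ M.H, ∀ x, G n x ∈ Set.Icc (0 : ℝ) M.H)
    (hrec : ∀ n < M.H, ∀ x, G (n + 1) x ≤
      β x (π (M.H - n) x) + ρ * mean (M.P x (π (M.H - n) x)) (G n)) (n : ℕ) (hn : n ≤ M.H) :
    ∀ (s : ℝ), 0 ≤ s → ∀ x, ev (M.rollout π n (M.H + 1 - n) x)
      (fun τ => ENNReal.ofReal (Real.exp (s * (G n x - weightedSum β ρ τ)))) ≤
      ENNReal.ofReal (Real.exp (n * ((s * ρ ^ n) ^ 2 * (M.H : ℝ) ^ 2 / 2))) := by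
  induction n with
  | zero =>
    intro s _ x
    rw [MDP.rollout, ev_pure]
    simp [weightedSum, hzero]
  | succ n ih =>
    -- The scale s stays general in the induction because each step multiplies it by ρ.
    intro s hs x
    have hs' : 0 ≤ s * ρ := mul_nonneg hs (by linarith)
    rw [ev_rollout_succ, show M.H + 1 - (n + 1) = M.H - n by omega,
      show M.H - n + 1 = M.H + 1 - n by omega]
    set a := π (M.H - n) x with ha
    set m := mean (M.P x a) (G n) with hm
    -- The recursion splits the exponent into a centred one-step fluctuation at scale sρ and the
    -- same quantity for the remaining trajectory.
    have h1 : ∀ y τ, ENNReal.ofReal (Real.exp (s * (G (n + 1) x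
          - weightedSum β ρ ((x, a, y) :: τ)))) ≤
        ENNReal.ofReal (Real.exp (-(s * ρ) * (G n y - m))) *
          ENNReal.ofReal (Real.exp ((s * ρ) * (G n y - weightedSum β ρ τ))) := by
      intro y τ
      rw [← ENNReal.ofReal_mul (Real.exp_nonneg _), ← Real.exp_add]
      refine ENNReal.ofReal_le_ofReal (Real.exp_le_exp.2 ?_)
      have h2 := mul_le_mul_of_nonneg_left (hrec n hn x) hs
      rw [← ha, ← hm] at h2
      rw [weightedSum]
      linarith
    set B := (s * ρ * ρ ^ n) ^ 2 * (M.H : ℝ) ^ 2 / 2 with hB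
    calc _ ≤ ev (M.P x a) (fun y => ENNReal.ofReal (Real.exp (n * B)) *
          ENNReal.ofReal (Real.exp (-(s * ρ) * (G n y - m)))) := by
          refine ev_mono _ fun y _ => ?_
          refine (ev_mono _ fun τ _ => h1 y τ).trans ?_
          rw [ev_const_mul, mul_comm]
          exact mul_le_mul_left (ih (by omega) (s * ρ) hs' y) _
      _ ≤ ENNReal.ofReal (Real.exp (n * B)) * ENNReal.ofReal (Real.exp B) := by
          rw [ev_const_mul, ev_ofReal _ _ fun y => Real.exp_nonneg _]
          refine mul_le_mul_right (ENNReal.ofReal_le_ofReal ?_) _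
          refine (mean_exp_le (M.P x a) (G n) M.H (-(s * ρ)) (fun y => (hG n (by omega) y).1)
            (fun y => (hG n (by omega) y).2)).trans (Real.exp_le_exp.2 ?_)
          rw [hB, neg_sq]
          -- Every step is charged at the largest scale, so the variance proxies are equal.
          have : s * ρ ≤ s * ρ * ρ ^ n := le_mul_of_one_le_right hs' (one_le_pow₀ hρ)
          gcongr
      _ = _ := by
          rw [← ENNReal.ofReal_mul (Real.exp_nonneg _), ← Real.exp_add, hB]
          congr 2
          push_cast
          ring

variable [Fintype S] [Fintype A] [DecidableEq S] [DecidableEq A]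

lemma sum_map_eq_sum_count (f : S → A → ℝ) (τ : List (Transition S A)) :
    (τ.map fun t => f t.1 t.2.1).sum
      = ∑ x, ∑ a, ((∑ y, τ.count (x, a, y) : ℕ) : ℝ) * f x a := by
  induction τ with
  | nil => simp
  | cons t τ ih =>
    obtain ⟨x, a, y⟩ := t
    have h : ∀ x' a', ((∑ y', ((x, a, y) :: τ).count (x', a', y') : ℕ) : ℝ) * f x' a'
        = (if x = x' then (if a = a' then f x' a' else 0) else 0)
          + ((∑ y', τ.count (x', a', y') : ℕ) : ℝ) * f x' a' := by
      intro x' a'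
      by_cases h : x = x' ∧ a = a'
      · obtain ⟨rfl, rfl⟩ := h
        simp [List.count_cons, Finset.sum_add_distrib]
        ring
      · have h' : ∀ y', ((x, a, y) == (x', a', y')) = false := by
          intro y'
          simp only [beq_eq_false_iff_ne, ne_eq, Prod.mk.injEq]
          tauto
        have : (if x = x' then (if a = a' then f x' a' else 0) else 0) = 0 := by
          split_ifs <;> tauto
        simp [List.count_cons, h', this]
    simp only [h, Finset.sum_add_distrib, List.map_cons, List.sum_cons, ih]
    simp

lemma sum_sum_count (τ : List (Transition S A)) :
    ∑ x, ∑ a, (∑ y, τ.count (x, a, y)) = τ.length := by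
  have := sum_map_eq_sum_count (fun _ _ => 1) τ
  simp only [List.map_const', List.sum_replicate, mul_one, nsmul_eq_mul] at this
  exact_mod_cast this.symm

lemma sum_count_le_length (τ : List (Transition S A)) (x : S) (a : A) :
    ∑ y, τ.count (x, a, y) ≤ τ.length := by
  rw [← sum_sum_count τ]
  refine le_trans ?_ (Finset.single_le_sum (f := fun x => ∑ a, ∑ y, τ.count (x, a, y))
    (fun _ _ => Nat.zero_le _) (Finset.mem_univ x))
  exact Finset.single_le_sum (f := fun a => ∑ y, τ.count (x, a, y))
    (fun _ _ => Nat.zero_le _) (Finset.mem_univ a)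

lemma sum_sum_countPair_le {H : ℕ} (D : List (Episode S A)) (hD : ∀ e ∈ D, e.2.length = H) :
    ∑ x, ∑ a, countPair D x a = D.length * H := by
  induction D with
  | nil => simp [countPair_nil]
  | cons e D ih =>
    simp only [countPair_cons, Finset.sum_add_distrib, sum_sum_count]
    rw [ih fun e he => hD e (List.mem_cons_of_mem _ he), hD e List.mem_cons_self,
      List.length_cons]
    ring

/-- With N earlier visits and m ≤ H visits in one episode, all charged f N, the charges fit under
the shifted sum because N + i - H ≤ N for i < m. -/
lemma mul_add_sum_range_le {f : ℕ → ℝ} (hf : Antitone f) {m H : ℕ} (hm : m ≤ H) (N : ℕ) :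
    m * f N + ∑ j ∈ Finset.range N, f (j - H) ≤ ∑ j ∈ Finset.range (m + N), f (j - H) := by
  rw [add_comm m, Finset.sum_range_add, add_comm]
  refine add_le_add le_rfl ?_
  calc (m : ℝ) * f N = ∑ _i ∈ Finset.range m, f N := by simp
    _ ≤ _ := Finset.sum_le_sum fun i hi => hf (by have := Finset.mem_range.1 hi; omega)

end Path

/-! ### From gaps to regret. -/

section Regret

variable {S A : Type*} [Fintype S]

section Decidable

variable [DecidableEq S] [DecidableEq A]

/-- The event on which the optimistic values computed from the data are reliable. -/
def Reliable (M : MDP S A) (T : ℕ) (l lam : ℝ) (D : List (Episode S A)) : Prop :=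
  AlwaysConcentrated M T l lam D ∧ ∀ x a, countPair D x a ≤ T

lemma Reliable.tail {M : MDP S A} {T : ℕ} {l lam : ℝ} {e : Episode S A}
    {D : List (Episode S A)} (h : Reliable M T l lam (e :: D)) : Reliable M T l lam D :=
  ⟨h.1.2, fun x a => le_trans (by rw [countPair_cons]; omega) (h.2 x a)⟩

end Decidable

variable [Fintype A]

/-- The error allowance of a state-action pair, given the data. -/
def pairError (M : MDP S A) (K : ℕ) (δ l lam : ℝ) (N : ℕ) : ℝ :=
  stepError M.H (M.H * (7 * bonusLog M K δ + √(2 * l)))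
    (Fintype.card S * (M.H * l / lam)) N

variable {M : MDP S A} {K : ℕ} {δ : ℝ} {l lam : ℝ}

lemma pairError_nonneg (hl : 0 < l) (hlam : 0 < lam)
    (hb : √(2 * l) ≤ 7 * bonusLog M K δ) (N : ℕ) : 0 ≤ pairError M K δ l lam N := by
  have hbon : 0 ≤ bonusLog M K δ := by linarith [Real.sqrt_nonneg (2 * l)]
  exact stepError_nonneg (by positivity) (by positivity) N

lemma pairError_antitone (hH : 0 < M.H) (hl : 0 < l) (hlam : 0 < lam)
    (hb : √(2 * l) ≤ 7 * bonusLog M K δ) : Antitone (pairError M K δ l lam) := by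
  have hbon : 0 ≤ bonusLog M K δ := by linarith [Real.sqrt_nonneg (2 * l)]
  exact stepError_antitone hH (by positivity) (by positivity)

/-- Cauchy–Schwarz over the SA pairs. -/
lemma sum_sum_sqrt_le (N : S → A → ℕ) (T : ℕ) (hN : ∑ x, ∑ a, N x a = T) :
    ∑ x, ∑ a, √(N x a : ℝ) ≤ √(Fintype.card S * Fintype.card A * T) := by
  refine Real.le_sqrt_of_sq_le ?_
  have h := sq_sum_le_card_mul_sum_sq (s := (Finset.univ : Finset (S × A)))
    (f := fun p => √(N p.1 p.2 : ℝ))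
  simp only [Real.sq_sqrt (Nat.cast_nonneg _), Fintype.sum_prod_type, Finset.card_univ,
    Fintype.card_prod] at h
  refine h.trans_eq ?_
  rw [← hN]
  push_cast
  ring

lemma sum_sum_pairError_le {T : ℕ} (hH : 0 < M.H) (hl : 0 < l) (hlam : 0 < lam)
    (hb : √(2 * l) ≤ 7 * bonusLog M K δ) (hT : 0 < T) (N : S → A → ℕ)
    (hN : ∑ x, ∑ a, N x a = T) :
    ∑ x, ∑ a, ∑ j ∈ Finset.range (N x a), pairError M K δ l lam (j - M.H) ≤
      Fintype.card S * Fintype.card A * (2 * (M.H : ℝ) ^ 2)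
      + M.H * (7 * bonusLog M K δ + √(2 * l)) *
        (Fintype.card S * Fintype.card A * (2 * √M.H)
          + 2 * √(Fintype.card S * Fintype.card A * T))
      + Fintype.card S * (M.H * l / lam) * (Fintype.card S * Fintype.card A)
        * (3 + Real.log T) := by
  have hbon : 0 ≤ bonusLog M K δ := by linarith [Real.sqrt_nonneg (2 * l)]
  have hc1 : 0 ≤ M.H * (7 * bonusLog M K δ + √(2 * l)) := by positivity
  have hc2 : 0 ≤ Fintype.card S * (M.H * l / lam) := by positivity
  have hNT : ∀ x a, N x a ≤ T := by
    intro x a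
    rw [← hN]
    refine le_trans ?_ (Finset.single_le_sum (f := fun x => ∑ a, N x a)
      (fun _ _ => Nat.zero_le _) (Finset.mem_univ x))
    exact Finset.single_le_sum (f := fun a => N x a) (fun _ _ => Nat.zero_le _)
      (Finset.mem_univ a)
  have h1 := Finset.sum_le_sum fun x (_ : x ∈ Finset.univ) =>
    Finset.sum_le_sum fun a (_ : a ∈ Finset.univ) =>
      sum_stepError_le hH hc1 hc2 (hNT x a) hT
  refine h1.trans ?_
  have h2 := mul_le_mul_of_nonneg_left (sum_sum_sqrt_le N T hN) hc1
  simp only [Finset.sum_add_distrib, ← Finset.mul_sum, Finset.sum_const, Finset.card_univ,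
    nsmul_eq_mul, mul_add] at h2 ⊢
  linarith

variable [DecidableEq S] [DecidableEq A]

open Classical in
/-- The accumulated difference between the gaps at the initial states and their realized bounds,
summed over the episodes before which the data were reliable. -/
def gapExcess (M : MDP S A) (K : ℕ) (δ l lam : ℝ) (T : ℕ)
    (learner : List (Episode S A) → Policy S A) : List (Episode S A) → ℝ
  | [] => 0
  | e :: D => gapExcess M K δ l lam T learner D + if Reliable M T l lam D then
      gap M K δ D (learner D) M.H e.1 -
        weightedSum (fun x a => pairError M K δ l lam (countPair D x a)) (1 + lam) e.2
      else 0

variable {learner : List (Episode S A) → Policy S A} {T : ℕ}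

/-- Reliability is decided by the data before the episode, so switching off unreliable episodes
preserves the supermartingale property. -/
lemma ev_exp_gapExcess_le [Nonempty A] (init : List (Episode S A) → PMF S)
    (hlearner : IsUCBVICH M K δ learner) (hl : 0 < l) (hlam : 0 < lam) (hlam1 : lam ≤ 1)
    (hb : √(2 * l) ≤ 7 * bonusLog M K δ) {s : ℝ} (hs : 0 ≤ s) (k : ℕ) :
    ev (interaction M init learner k) (fun D => ENNReal.ofReal (Real.exp
      (s * gapExcess M K δ l lam T learner D
        - D.length * (M.H * ((s * (1 + lam) ^ M.H) ^ 2 * (M.H : ℝ) ^ 2 / 2))))) ≤ 1 := by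
  set v : ℝ := M.H * ((s * (1 + lam) ^ M.H) ^ 2 * (M.H : ℝ) ^ 2 / 2) with hv
  have hv0 : 0 ≤ v := by positivity
  refine (ev_interaction_le M init learner _ (fun D x => ?_) k).trans_eq
    (by simp [gapExcess])
  by_cases hD : Reliable M T l lam D
  · have h := ev_exp_sub_weightedSum_le M (learner D) (gap M K δ D (learner D))
      (fun x a => pairError M K δ l lam (countPair D x a)) (ρ := 1 + lam) (by linarith)
      (fun x => by simp [gap, polVal, maxQ, ucbQToGo_zero])
      (fun n hn x => gap_mem_Icc hl hb hD.1 hD.2 _ hn x)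
      (fun n hn x => gap_succ_le hl hlam hlam1 hb hD.1 hD.2 hn x fun a => by
        have := hlearner D (M.H - n) (by omega) (by omega) x a
        rwa [ucbQ, ucbQ, show M.H + 1 - (M.H - n) = n + 1 by omega] at this)
      M.H le_rfl s hs x
    rw [Nat.add_sub_cancel_left, ← hv] at h
    have e : ∀ τ : List (Transition S A), ENNReal.ofReal (Real.exp
          (s * gapExcess M K δ l lam T learner ((x, τ) :: D)
            - ((x, τ) :: D).length * v)) =
        ENNReal.ofReal (Real.exp (s * gapExcess M K δ l lam T learner D - D.length * v - v)) *
        ENNReal.ofReal (Real.exp (s * (gap M K δ D (learner D) M.H x - weightedSum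
          (fun x a => pairError M K δ l lam (countPair D x a)) (1 + lam) τ))) := by
      intro τ
      rw [← ENNReal.ofReal_mul (Real.exp_nonneg _), ← Real.exp_add, gapExcess, if_pos hD,
        List.length_cons]
      congr 2
      push_cast
      ring
    simp only [e, ev_const_mul]
    refine (mul_le_mul_right h _).trans_eq ?_
    rw [← ENNReal.ofReal_mul (Real.exp_nonneg _), ← Real.exp_add]
    congr 2
    ring
  · refine (ev_mono _ fun τ _ => ?_).trans_eq (ev_const _ _)
    refine ENNReal.ofReal_le_ofReal (Real.exp_le_exp.2 ?_)
    rw [gapExcess, if_neg hD, List.length_cons]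
    push_cast
    linarith

/-- Reliability of the final data is inherited by all earlier data, so no episode is switched off in
`gapExcess`. -/
lemma regret_le_gapExcess_add [Nonempty A] (hH : 0 < M.H) (hl : 0 < l) (hlam : 0 < lam)
    (hb : √(2 * l) ≤ 7 * bonusLog M K δ) (D : List (Episode S A)) :
    (∀ e ∈ D, e.2.length = M.H) → Reliable M T l lam D →
    regret M learner D ≤ gapExcess M K δ l lam T learner D + (1 + lam) ^ M.H *
      ∑ x, ∑ a, ∑ j ∈ Finset.range (countPair D x a), pairError M K δ l lam (j - M.H) := by
  induction D with
  | nil => simp [regret, gapExcess, countPair_nil]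
  | cons e D ih =>
    intro hlen hC
    have ih' := ih (fun e he => hlen e (List.mem_cons_of_mem _ he)) hC.tail
    have hD := hC.tail
    have hle := hlen e List.mem_cons_self
    rw [regret, gapExcess, if_pos hD]
    have h1 : M.optValue 1 e.1 - M.value (learner D) 1 e.1
        ≤ gap M K δ D (learner D) M.H e.1 := by
      have h2 := optValue_le_optVal M 1 e.1
      have h3 := optVal_le_maxQ_of_forall
        (add_mean_optVal_le_ucbQToGo hl hb D hD.1 hD.2) le_rfl e.1
      rw [Nat.add_sub_cancel] at h2
      rw [value_eq_polVal, gap, Nat.add_sub_cancel, Nat.add_sub_cancel_left]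
      linarith
    have h4 := weightedSum_le
      (β := fun x a => pairError M K δ l lam (countPair D x a))
      (fun x a => pairError_nonneg hl hlam hb _) (ρ := 1 + lam) (by linarith) e.2
    rw [sum_map_eq_sum_count fun x a => pairError M K δ l lam (countPair D x a), hle] at h4
    have h5 : (∑ x, ∑ a, ((∑ y, e.2.count (x, a, y) : ℕ) : ℝ) *
          pairError M K δ l lam (countPair D x a)) +
        ∑ x, ∑ a, ∑ j ∈ Finset.range (countPair D x a), pairError M K δ l lam (j - M.H) ≤
        ∑ x, ∑ a, ∑ j ∈ Finset.range (countPair (e :: D) x a),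
          pairError M K δ l lam (j - M.H) := by
      simp only [← Finset.sum_add_distrib]
      refine Finset.sum_le_sum fun x _ => Finset.sum_le_sum fun a _ => ?_
      rw [countPair_cons]
      exact mul_add_sum_range_le (pairError_antitone hH hl hlam hb)
        ((sum_count_le_length e.2 x a).trans_eq hle) _
    have h6 := mul_le_mul_of_nonneg_left h5 (by positivity : (0 : ℝ) ≤ (1 + lam) ^ M.H)
    rw [mul_add] at h6
    linarith

open Classical in
/-- The regret bound with explicit failure probability, before the constants are chosen. -/
lemma one_le_toOuterMeasure_add [Nonempty A] (init : List (Episode S A) → PMF S)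
    (hlearner : IsUCBVICH M K δ learner) (hH : 0 < M.H) (hK : 0 < K) (hl : 0 < l)
    (hlam : 0 < lam) (hlam1 : lam ≤ 1) (hb : √(2 * l) ≤ 7 * bonusLog M K δ) :
    1 ≤ (interaction M init learner K).toOuterMeasure {D | regret M learner D ≤
        (1 + lam) ^ M.H * (M.H * √(2 * l) * √(K * M.H : ℕ)
        + (Fintype.card S * Fintype.card A * (2 * (M.H : ℝ) ^ 2)
      + M.H * (7 * bonusLog M K δ + √(2 * l)) *
        (Fintype.card S * Fintype.card A * (2 * √M.H)
          + 2 * √(Fintype.card S * Fintype.card A * (K * M.H : ℕ)))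
      + Fintype.card S * (M.H * l / lam) * (Fintype.card S * Fintype.card A)
        * (3 + Real.log (K * M.H : ℕ))))} +
      (K * Fintype.card (TiltIndex S A M.H (K * M.H)) + 1) * ENNReal.ofReal (Real.exp (-l)) := by
  set T := K * M.H with hTdef
  have hT : 0 < T := Nat.mul_pos hK hH
  have hT' : (0 : ℝ) < T := by exact_mod_cast hT
  have hH' : (0 : ℝ) < M.H := by exact_mod_cast hH
  set E := {D | regret M learner D ≤ _}
  set r := √(2 * l) with hr
  have hr0 : 0 < r := Real.sqrt_pos.2 (by linarith)
  have hr2 : r ^ 2 = 2 * l := Real.sq_sqrt (by linarith)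
  set w := √(T : ℝ) with hw
  have hw0 : 0 < w := Real.sqrt_pos.2 hT'
  have hw2 : w ^ 2 = T := Real.sq_sqrt hT'.le
  set b := (1 + lam) ^ M.H * M.H with hbdef
  have hb0 : 0 < b := by positivity
  -- The optimal scale: the total compensator K v equals l, and the excess is then at most 2l/s = b
  -- r w.
  set s := r / (w * b) with hs
  have hs0 : 0 < s := by positivity
  set v : ℝ := M.H * ((s * (1 + lam) ^ M.H) ^ 2 * (M.H : ℝ) ^ 2 / 2) with hv
  have hKv : K * v = l := by
    have : K * v = T * (s * b) ^ 2 / 2 := by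
      rw [hv, hTdef, hbdef]
      push_cast
      ring
    rw [this, hs, ← hw2]
    have e : r / (w * b) * b = r / w := by field_simp
    rw [e, div_pow, mul_div_cancel₀ _ (by positivity), hr2]
    ring
  have h1 := ev_exp_gapExcess_le (T := T) init hlearner hl hlam hlam1 hb hs0.le K
  have h2 := ev_not_alwaysConcentrated_le M init learner T l lam K
  calc (1 : ℝ≥0∞) = ev (interaction M init learner K) (fun _ => 1) := (ev_const _ _).symm
    _ ≤ ev (interaction M init learner K) (fun D => E.indicator 1 D +
          ({D | ¬ AlwaysConcentrated M T l lam D}.indicator 1 D +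
          ENNReal.ofReal (Real.exp (-l)) * ENNReal.ofReal (Real.exp
            (s * gapExcess M K δ l lam T learner D - D.length * v)))) := by
        -- Pointwise, one of three terms is at least 1: the regret bound holds, concentration fails,
        -- or the exponential of the excess exceeds e^l.
        refine ev_mono _ fun D hD => ?_
        obtain ⟨hlen, hep⟩ := length_of_interaction_ne_zero M init learner K D hD
        by_cases hC : AlwaysConcentrated M T l lam D
        · by_cases hx : s * gapExcess M K δ l lam T learner D - D.length * v ≤ l
          · rw [Set.indicator_of_mem]
            · exact le_self_add
            have hsum : ∑ x, ∑ a, countPair D x a = T := by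
              rw [sum_sum_countPair_le D hep, hlen]
            have hrel : Reliable M T l lam D := by
              refine ⟨hC, fun x a => ?_⟩
              rw [← hsum]
              refine le_trans ?_ (Finset.single_le_sum (f := fun x => ∑ a, countPair D x a)
                (fun _ _ => Nat.zero_le _) (Finset.mem_univ x))
              exact Finset.single_le_sum (f := fun a => countPair D x a)
                (fun _ _ => Nat.zero_le _) (Finset.mem_univ a)
            have h3 := regret_le_gapExcess_add (learner := learner) hH hl hlam hb D hep hrel
            have h4 := mul_le_mul_of_nonneg_left
              (sum_sum_pairError_le hH hl hlam hb hT _ hsum)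
              (by positivity : (0 : ℝ) ≤ (1 + lam) ^ M.H)
            rw [hlen, hKv] at hx
            have h5 : gapExcess M K δ l lam T learner D ≤ b * r * w := by
              have h6 : s * gapExcess M K δ l lam T learner D ≤ s * (b * r * w) := by
                have : s * (b * r * w) = r ^ 2 := by
                  rw [hs]
                  field_simp
                linarith
              exact le_of_mul_le_mul_left h6 hs0
            change regret M learner D ≤ _
            rw [mul_add ((1 + lam) ^ M.H)]
            refine h3.trans (add_le_add (h5.trans_eq ?_) h4)
            rw [hbdef]
            ring
          · refine le_trans ?_ (le_add_left (le_add_left le_rfl))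
            rw [← ENNReal.ofReal_mul (Real.exp_nonneg _), ← Real.exp_add,
              ENNReal.one_le_ofReal, Real.one_le_exp_iff]
            linarith
        · rw [Set.indicator_of_mem (s := {D | ¬ AlwaysConcentrated M T l lam D}) hC]
          exact le_add_left le_self_add
    _ ≤ _ := by
        rw [ev_add, ev_add, ev_const_mul, add_mul, one_mul, mul_assoc]
        refine add_le_add (ev_indicator _ E).le (add_le_add h2 ?_)
        exact mul_le_of_le_one_right' h1

end Regret

/-! ### Numerical constants. -/

section Constants

lemma eight_fifths_le_log_five : (8 / 5 : ℝ) ≤ Real.log 5 := by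
  have h1 : Real.exp 8 ≤ 5 ^ 5 := by
    have := Real.exp_one_lt_d9.le
    calc Real.exp 8 = Real.exp 1 ^ 8 := by rw [← Real.exp_nat_mul]; norm_num
      _ ≤ 2.7182818286 ^ 8 := pow_le_pow_left₀ (Real.exp_nonneg _) this 8
      _ ≤ _ := by norm_num
  have h2 := (Real.le_log_iff_exp_le (by norm_num)).2 h1
  rw [Real.log_pow] at h2
  push_cast at h2
  linarith

lemma one_add_div_pow_le (H : ℕ) (hH : 0 < H) :
    (1 + 1 / (25 * (H : ℝ))) ^ H ≤ 1.041 := by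
  have hH' : (0 : ℝ) < H := by exact_mod_cast hH
  have h1 : 1 + 1 / (25 * (H : ℝ)) ≤ Real.exp (1 / (25 * H)) := by
    rw [add_comm]; exact Real.add_one_le_exp _
  calc _ ≤ Real.exp (1 / (25 * H)) ^ H := pow_le_pow_left₀ (by positivity) h1 H
    _ = Real.exp (1 / 25) := by
        rw [← Real.exp_nat_mul]
        congr 1
        field_simp
    _ ≤ 1.041 := by
        have := Real.exp_bound' (x := 1 / 25) (by norm_num) (by norm_num) (n := 3) (by norm_num)
        refine this.trans ?_
        norm_num [Finset.sum_range_succ, Nat.factorial]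

/-- The choice of constants in the regret bound. -/
lemma constants_le {H nS nA t L L' g r ρ : ℝ} (hH : 1 ≤ H) (hS : 1 ≤ nS) (hA : 1 ≤ nA)
    (ht0 : 0 ≤ t) (hL : 8 / 5 ≤ L) (hL' : L' ≤ L) (hg : 3 + g ≤ 2 * L)
    (hr : t ≤ r) (hρ0 : 0 ≤ ρ) (hρ : ρ ≤ 1.041) :
    ρ * (H * (2 * √L) * t + (nS * nA * (2 * H ^ 2)
      + H * (7 * L' + 2 * √L) * (nS * nA * (2 * √H) + 2 * r)
      + nS * (H * (2 * L) / (1 / (25 * H))) * (nS * nA) * (3 + g)))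
    ≤ 20 * H * L * r + 250 * H ^ 2 * nS ^ 2 * nA * L ^ 2 := by
  have hr0 : 0 ≤ r := ht0.trans hr
  set q := √L with hq
  have hq0 : 0 ≤ q := Real.sqrt_nonneg _
  have hq2 : q ^ 2 = L := Real.sq_sqrt (by linarith)
  -- Here 1.26² < 8/5. It lets √L be absorbed into L: 6√L + 14L ≤ 18.8L, and 1.041 · 18.8 < 20.
  have hq1 : 1.26 ≤ q := Real.le_sqrt_of_sq_le (by norm_num; linarith)
  have hqL : 1.26 * q ≤ L := by nlinarith
  have hsH : √H ≤ H := Real.sqrt_le_iff.2 ⟨by linarith, by nlinarith⟩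
  have hsH0 : 0 ≤ √H := Real.sqrt_nonneg _
  have e : nS * (H * (2 * L) / (1 / (25 * H))) * (nS * nA) * (3 + g)
      = (50 * H ^ 2 * nS ^ 2 * nA * L) * (3 + g) := by
    field_simp
    ring
  have b1 : H * (2 * q) * t ≤ H * (2 * q) * r := by gcongr
  have b2 : H * (7 * L' + 2 * q) * (nS * nA * (2 * √H) + 2 * r)
      ≤ H * (7 * L + 2 * q) * (nS * nA * (2 * H) + 2 * r) := by
    gcongr
  have b3 : (50 * H ^ 2 * nS ^ 2 * nA * L) * (3 + g) ≤
      (50 * H ^ 2 * nS ^ 2 * nA * L) * (2 * L) := by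
    gcongr
  have b4 : nS * nA * H ^ 2 ≤ nS ^ 2 * nA * H ^ 2 := by
    gcongr
    nlinarith
  have hU : 0 ≤ H * r := by positivity
  have hV : 0 ≤ nS * nA * H ^ 2 := by positivity
  have hW : 0 ≤ nS ^ 2 * nA * H ^ 2 := by positivity
  have b5 : H * r * (6 * q + 14 * L) ≤ H * r * (18.8 * L) :=
    mul_le_mul_of_nonneg_left (by linarith) hU
  have hLL : 1.6 * L ≤ L ^ 2 := by nlinarith
  have b6 : nS * nA * H ^ 2 * (2 + 14 * L + 4 * q) ≤ nS ^ 2 * nA * H ^ 2 * (13 * L ^ 2) :=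
    mul_le_mul b4 (by nlinarith) (by positivity) hW
  have hX : H * (2 * q) * t + (nS * nA * (2 * H ^ 2)
      + H * (7 * L' + 2 * q) * (nS * nA * (2 * √H) + 2 * r)
      + nS * (H * (2 * L) / (1 / (25 * H))) * (nS * nA) * (3 + g))
      ≤ H * r * (18.8 * L) + nS ^ 2 * nA * H ^ 2 * (113 * L ^ 2) := by
    rw [e]
    linarith
  have hY : 0 ≤ H * r * (18.8 * L) + nS ^ 2 * nA * H ^ 2 * (113 * L ^ 2) := by positivity
  calc _ ≤ ρ * (H * r * (18.8 * L) + nS ^ 2 * nA * H ^ 2 * (113 * L ^ 2)) :=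
        mul_le_mul_of_nonneg_left hX hρ0
    _ ≤ 1.041 * (H * r * (18.8 * L) + nS ^ 2 * nA * H ^ 2 * (113 * L ^ 2)) :=
        mul_le_mul_of_nonneg_right hρ hY
    _ ≤ _ := by
        have h1 : 0 ≤ H * r * L := by positivity
        have h2 : 0 ≤ nS ^ 2 * nA * H ^ 2 * L ^ 2 := by positivity
        linarith

/-- The right side is (δX)² for the argument X of the logarithm L, so the failure weight e^(-2L) =
X⁻² outweighs the number of events, including the one for the excess. -/
lemma card_tiltIndex_le (S A : Type*) [Fintype S] [Fintype A] {K H : ℕ} (hK : 0 < K) (hH : 0 < H)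
    (hS : 0 < Fintype.card S) (hA : 0 < Fintype.card A) :
    K * Fintype.card (TiltIndex S A H (K * H)) + 1 ≤
      25 * (H * Fintype.card S * Fintype.card A * (K * H)) ^ 2 := by
  simp only [TiltIndex, Fintype.card_sum, Fintype.card_prod, Fintype.card_fin, Fintype.card_bool]
  generalize Fintype.card S = s at *
  generalize Fintype.card A = a at *
  set Y := H * s * a * (K * H) with hY
  have hY1 : 0 < Y := by positivity
  have h1 : K * (s * (a * (H * (K * H * 2)))) ≤ 2 * Y ^ 2 := by
    have : K * (s * (a * (H * (K * H * 2)))) = 2 * (K * Y) := by rw [hY]; ring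
    rw [this, sq]
    gcongr
    calc K = 1 * 1 * 1 * (K * 1) := by ring
      _ ≤ H * s * a * (K * H) := by gcongr <;> omega
  have h2 : K * (s * (a * s)) ≤ Y ^ 2 := by
    calc K * (s * (a * s)) = (1 * s * 1 * (K * 1)) * (1 * s * a * (1 * 1)) := by ring
      _ ≤ (H * s * a * (K * H)) * (H * s * a * (K * H)) := by gcongr <;> omega
      _ = Y ^ 2 := by rw [hY]; ring
  have h3 : 1 ≤ Y ^ 2 := Nat.one_le_pow _ _ hY1
  rw [mul_add]
  omega

end Constants

/-! ### Degenerate cases and assembly. -/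

section Main

variable {S A : Type*} [Fintype S] [Fintype A]

lemma regret_nonpos (M : MDP S A) (learner : List (Episode S A) → Policy S A)
    (hH : M.H = 0) (D : List (Episode S A)) : regret M learner D ≤ 0 := by
  induction D with
  | nil => exact le_rfl
  | cons e D ih =>
    have : Nonempty A := ⟨learner [] 0 e.1⟩
    have h1 := optValue_le_optVal M 1 e.1
    rw [regret, value_eq_polVal]
    simp only [hH, zero_add, Nat.sub_self, optVal, polVal] at h1 ⊢
    linarith

lemma toOuterMeasure_eq_one_of_mul_eq_zero (M : MDP S A) (K : ℕ)
    (init : List (Episode S A) → PMF S) (learner : List (Episode S A) → Policy S A)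
    (h : K = 0 ∨ M.H = 0) {s : Set (List (Episode S A))}
    (hs : {D | regret M learner D ≤ 0} ⊆ s) :
    (interaction M init learner K).toOuterMeasure s = 1 := by
  rw [PMF.toOuterMeasure_apply_eq_one_iff]
  refine fun D hD => hs ?_
  rcases h with rfl | h
  · rw [interaction, PMF.mem_support_pure_iff] at hD
    simp [hD, regret]
  · exact regret_nonpos M learner h D

variable [DecidableEq S] [DecidableEq A]

/-- The regret bound for a nontrivial horizon, number of episodes and confidence level. -/
lemma ofReal_le_toOuterMeasure_regret_le (M : MDP S A) (K : ℕ) (δ : ℝ) (hδ : 0 < δ) (hδ1 : δ < 1)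
    (init : List (Episode S A) → PMF S) (learner : List (Episode S A) → Policy S A)
    (hlearner : IsUCBVICH M K δ learner) (hK : 0 < K) (hH : 0 < M.H) {L : ℝ}
    (hL : L = Real.log (5 * M.H * Fintype.card S * Fintype.card A * (K * M.H) / δ)) :
    8 / 5 ≤ L ∧ ENNReal.ofReal (1 - δ) ≤ (interaction M init learner K).toOuterMeasure
      {D | regret M learner D ≤
        20 * M.H * L * √(Fintype.card S * Fintype.card A * (K * M.H))
          + 250 * (M.H : ℝ) ^ 2 * (Fintype.card S : ℝ) ^ 2 * Fintype.card A * L ^ 2} := by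
  obtain ⟨x₀, -⟩ := (init []).support_nonempty
  have : Nonempty S := ⟨x₀⟩
  have : Nonempty A := ⟨learner [] 0 x₀⟩
  have hS : 0 < Fintype.card S := Fintype.card_pos
  have hA : 0 < Fintype.card A := Fintype.card_pos
  have hcard := card_tiltIndex_le S A hK hH hS hA
  have hS1 : (1 : ℝ) ≤ Fintype.card S := by exact_mod_cast hS
  have hA1 : (1 : ℝ) ≤ Fintype.card A := by exact_mod_cast hA
  have hH1 : (1 : ℝ) ≤ M.H := by exact_mod_cast hH
  have hK1 : (1 : ℝ) ≤ K := by exact_mod_cast hK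
  set L' := bonusLog M K δ with hL'def
  set Z : ℝ := 5 * Fintype.card S * Fintype.card A * ((K : ℝ) * M.H) / δ with hZ
  set X : ℝ := 5 * M.H * Fintype.card S * Fintype.card A * (K * M.H) / δ with hX
  have hXZ : X = M.H * Z := by rw [hX, hZ]; ring
  have hT1 : (1 : ℝ) ≤ K * M.H := one_le_mul_of_one_le_of_one_le hK1 hH1
  have hSA1 : (1 : ℝ) ≤ Fintype.card S * Fintype.card A :=
    one_le_mul_of_one_le_of_one_le hS1 hA1
  have hZT : 5 * ((K : ℝ) * M.H) ≤ Z := by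
    rw [hZ, le_div_iff₀ hδ]
    calc 5 * ((K : ℝ) * M.H) * δ ≤ 5 * ((K : ℝ) * M.H) * 1 := by gcongr
      _ ≤ 5 * ((K : ℝ) * M.H) * (Fintype.card S * Fintype.card A) := by gcongr
      _ = _ := by ring
  have hZ5 : 5 ≤ Z := by linarith
  have hZ0 : 0 < Z := by linarith
  have hZX : Z ≤ X := by rw [hXZ]; exact le_mul_of_one_le_left hZ0.le hH1
  have hX0 : 0 < X := hZ0.trans_le hZX
  have hHZ : (M.H : ℝ) ≤ Z := by
    have : (M.H : ℝ) ≤ K * M.H := le_mul_of_one_le_left (by linarith) hK1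
    linarith
  have hL'L : L' ≤ L := by rw [hL]; exact Real.log_le_log hZ0 hZX
  have hL'5 : 8 / 5 ≤ L' := eight_fifths_le_log_five.trans (Real.log_le_log (by norm_num) hZ5)
  have hL5 : 8 / 5 ≤ L := hL'5.trans hL'L
  -- The bonus uses the logarithm L' without the factor H. Since H ≤ Z, it loses at most a factor 2,
  -- and 2√L ≤ 7L' still holds.
  have hLL' : L ≤ 2 * L' := by
    rw [hL, hXZ, Real.log_mul (by linarith) hZ0.ne', two_mul]
    exact add_le_add (Real.log_le_log (by linarith) hHZ) le_rfl
  have hlogT : 3 + Real.log ((K * M.H : ℕ) : ℝ) ≤ 2 * L := by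
    have h1 : Real.log (5 * ((K : ℝ) * M.H)) ≤ L := by
      rw [hL]; exact Real.log_le_log (by linarith) (hZT.trans hZX)
    rw [Real.log_mul (by norm_num) (by linarith)] at h1
    have := eight_fifths_le_log_five
    push_cast
    linarith
  have hsqrt : √(2 * (2 * L)) = 2 * √L := by
    rw [show 2 * (2 * L) = 2 ^ 2 * L by ring, Real.sqrt_mul (by norm_num),
      Real.sqrt_sq (by norm_num)]
  have hb : √(2 * (2 * L)) ≤ 7 * bonusLog M K δ := by
    rw [← hL'def]
    refine Real.sqrt_le_iff.2 ⟨by linarith, ?_⟩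
    nlinarith
  refine ⟨hL5, ?_⟩
  have hlam1 : 1 / (25 * (M.H : ℝ)) ≤ 1 := by
    rw [div_le_one (by linarith)]
    linarith
  -- Taking l = 2L pays for a number of events quadratic in HSAT; λ of order 1/H keeps the
  -- compounded factor bounded.
  have hmain := one_le_toOuterMeasure_add (l := 2 * L) (lam := 1 / (25 * (M.H : ℝ))) init
    hlearner hH hK (by linarith) (by positivity) hlam1 hb
  have hfail : ((K : ℝ≥0∞) * Fintype.card (TiltIndex S A M.H (K * M.H)) + 1) *
      ENNReal.ofReal (Real.exp (-(2 * L))) ≤ ENNReal.ofReal δ := by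
    have e1 : ((K : ℝ≥0∞) * Fintype.card (TiltIndex S A M.H (K * M.H)) + 1)
        = ENNReal.ofReal ((K * Fintype.card (TiltIndex S A M.H (K * M.H)) + 1 : ℕ) : ℝ) := by
      rw [ENNReal.ofReal_natCast]
      push_cast
      rfl
    have e2 : Real.exp (-(2 * L)) = 1 / X ^ 2 := by
      rw [Real.exp_neg, hL, two_mul, Real.exp_add, Real.exp_log hX0, one_div, sq]
    rw [e1, e2, ← ENNReal.ofReal_mul (Nat.cast_nonneg _)]
    refine ENNReal.ofReal_le_ofReal ?_
    rw [mul_one_div, div_le_iff₀ (by positivity)]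
    have h1 : ((K * Fintype.card (TiltIndex S A M.H (K * M.H)) + 1 : ℕ) : ℝ)
        ≤ 25 * (M.H * Fintype.card S * Fintype.card A * (K * M.H)) ^ 2 := by
      exact_mod_cast hcard
    have h2 : δ * X = 5 * (M.H * Fintype.card S * Fintype.card A * (K * M.H)) := by
      rw [hX]; field_simp
    have h3 : (δ * X) ^ 2 ≤ δ * X ^ 2 := by
      rw [mul_pow]
      exact mul_le_mul_of_nonneg_right (by nlinarith) (sq_nonneg _)
    rw [h2] at h3
    calc _ ≤ _ := h1
      _ = (5 * (M.H * Fintype.card S * Fintype.card A * ((K : ℝ) * M.H))) ^ 2 := by ring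
      _ ≤ _ := h3
  rw [ENNReal.ofReal_sub _ hδ.le, ENNReal.ofReal_one, tsub_le_iff_right]
  refine hmain.trans (add_le_add ?_ hfail)
  refine (interaction M init learner K).toOuterMeasure.mono fun D hD => ?_
  rw [Set.mem_ofPred_eq] at hD ⊢
  refine hD.trans ?_
  rw [hsqrt, ← hL'def]
  refine (constants_le hH1 hS1 hA1 (Real.sqrt_nonneg _) hL5 hL'L hlogT ?_ (by positivity)
    (one_add_div_pow_le M.H hH)).trans_eq (by push_cast; rfl)
  refine Real.sqrt_le_sqrt ?_
  exact le_mul_of_one_le_left (Nat.cast_nonneg _) hSA1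

end Main

end UCBVI

end

theorem theorem1 {S A : Type*} [Fintype S] [Fintype A] [DecidableEq S] [DecidableEq A]
    (M : UCBVI.MDP S A) (K : ℕ) (δ : ℝ) (hδ : 0 < δ)
    (init : List (UCBVI.Episode S A) → PMF S)
    (learner : List (UCBVI.Episode S A) → UCBVI.Policy S A)
    (hlearner : UCBVI.IsUCBVICH M K δ learner)
    (nS nA H T L : ℝ)
    (hS : nS = Fintype.card S) (hA : nA = Fintype.card A) (hH : H = M.H) (hT : T = K * H)
    (hL : L = Real.log (5 * H * nS * nA * T / δ)) :
    ENNReal.ofReal (1 - δ) ≤ (UCBVI.interaction M init learner K).toOuterMeasure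
        {D | UCBVI.regret M learner D
          ≤ 20 * H ^ (3 / 2 : ℝ) * L * √(nS * nA * K) + 250 * H ^ 2 * nS ^ 2 * nA * L ^ 2} ∧
    (H ^ 2 * nS ^ 3 * nA ≤ T →
      ENNReal.ofReal (1 - δ) ≤ (UCBVI.interaction M init learner K).toOuterMeasure
        {D | UCBVI.regret M learner D ≤ 270 * H * √(nS * nA * T) * L ^ 2}) := by
  rcases le_or_gt 1 δ with hδ1 | hδ1
  · rw [ENNReal.ofReal_of_nonpos (by linarith)]
    exact ⟨zero_le, fun _ => zero_le⟩
  by_cases h0 : K = 0 ∨ M.H = 0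
  · have hT0 : T = 0 := by
      rcases h0 with h | h <;> simp [hT, hH, h]
    -- Here the logarithm of 0 is 0 by convention, so both bounds are 0, and the regret is
    -- nonpositive.
    have hL0 : L = 0 := by simp [hL, hT0]
    have hone : ENNReal.ofReal (1 - δ) ≤ 1 := ENNReal.ofReal_le_one.2 (by linarith)
    refine ⟨hone.trans_eq (UCBVI.toOuterMeasure_eq_one_of_mul_eq_zero M K init learner h0 ?_).symm,
      fun _ => hone.trans_eq
        (UCBVI.toOuterMeasure_eq_one_of_mul_eq_zero M K init learner h0 ?_).symm⟩
    · simp [hL0]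
    · simp [hL0]
  push Not at h0
  have hK : 0 < K := Nat.pos_of_ne_zero h0.1
  have hH0 : 0 < M.H := Nat.pos_of_ne_zero h0.2
  obtain ⟨hL5, hmain⟩ := UCBVI.ofReal_le_toOuterMeasure_regret_le M K δ hδ hδ1 init learner
    hlearner hK hH0 (L := L) (by rw [hL, hT, hS, hA, hH])
  rw [← hS, ← hA, ← hH, ← hT] at hmain
  have hHpos : 0 < H := by rw [hH]; exact_mod_cast hH0
  have hnS : 0 ≤ nS := by rw [hS]; positivity
  have hnA : 0 ≤ nA := by rw [hA]; positivity
  constructor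
  · have e : 20 * H ^ (3 / 2 : ℝ) * L * √(nS * nA * K) = 20 * H * L * √(nS * nA * T) := by
      have h1 : H ^ (3 / 2 : ℝ) = H * √H := by
        rw [show (3 / 2 : ℝ) = 1 + 1 / 2 by norm_num, Real.rpow_add hHpos, Real.rpow_one,
          Real.sqrt_eq_rpow]
      have h2 : √(nS * nA * T) = √H * √(nS * nA * K) := by
        rw [← Real.sqrt_mul hHpos.le, hT]
        congr 1
        ring
      rw [h1, h2]
      ring
    rw [e]
    exact hmain
  · intro hlarge
    refine hmain.trans ((UCBVI.interaction M init learner K).toOuterMeasure.mono fun D hD => ?_)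
    rw [Set.mem_ofPred_eq] at hD ⊢
    refine hD.trans ?_
    set r := √(nS * nA * T) with hr
    -- This is where T ≥ H²S³A enters: the lower-order term drops below H√(SAT)L², and 20 + 250 =
    -- 270 as L ≤ L².
    have h1 : H * nS ^ 2 * nA ≤ r := by
      refine Real.le_sqrt_of_sq_le ?_
      calc (H * nS ^ 2 * nA) ^ 2 = nS * nA * (H ^ 2 * nS ^ 3 * nA) := by ring
        _ ≤ nS * nA * T := by gcongr
    have hr0 : 0 ≤ r := Real.sqrt_nonneg _
    have h2 : H * r * L ≤ H * r * L ^ 2 :=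
      mul_le_mul_of_nonneg_left (by nlinarith) (by positivity)
    have h3 : H * L ^ 2 * (H * nS ^ 2 * nA) ≤ H * L ^ 2 * r := by gcongr
    linarith
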